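/- Let $S^1=\mathbb R/\mathbb Z$ and let $s>5/2$. For $r>1/2$ let $H^r(S^1)$ be the Sobolev space of real functions on $S^1$, with norm $\|f\|^2=\sum_{n\in\mathbb Z}(1+n^2)^r|\hat f(n)|^2$, and let $H^r_0(S^1)=\{u\in H^r(S^1): u(0)=0\}$. Let $\mathrm{Diff}^s_0(S^1)$ be the set of orientation-preserving diffeomorphisms $\varphi$ of $S^1$ of class $H^s$ with $\varphi(0)=0$; lifted to $\mathbb R$ with $\varphi(0)=0$, these are the maps $\varphi=\mathrm{id}+u$ with $u\in H^s_0(S^1)$ and $\varphi_x>0$. Let $G^s=\mathrm{Diff}^s_0(S^1)\ltimes H^{s-1}(S^1)$ be the semidirect product with multiplication $(\varphi,\alpha)(\psi,\beta)=(\varphi\circ\psi,\ \beta+\alpha\circ\psi)$, viewed as a Banach manifold, namely as an open subset of $H^s_0(S^1)\times H^{s-1}(S^1)$ via $(\varphi,\alpha)\mapsto(\varphi-\mathrm{id},\alpha)$. Equip $G^s$ with the right-invariant indefinite metric which at the identity is $$\langle (u_1,u_2),(v_1,v_2)\rangle_{(\mathrm{id},0)}=\frac14\int_{S^1}\bigl(u_{1x}v_{1x}-u_2v_2\bigr)\,dx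 ,$$ that is, $\langle U,V\rangle_{(\varphi,\alpha)}=\langle (U_1\circ\varphi^{-1},U_2\circ\varphi^{-1}),(V_1\circ\varphi^{-1},V_2\circ\varphi^{-1})\rangle_{(\mathrm{id},0)}$. On $L^2(S^1;\mathbb R^2)$ let $\langle\!\langle X,Y\rangle\!\rangle=\int_{S^1}(X_1Y_1-X_2Y_2)\,dx$, and let $\mathcal S=\{f\in L^2(S^1;\mathbb R^2):\langle\!\langle f,f\rangle\!\rangle=1\}$ be the unit pseudosphere. Let $\mathcal S^{s-1}=\mathcal S\cap H^{s-1}(S^1;\mathbb R^2)$, a submanifold of $H^{s-1}(S^1;\mathbb R^2)$, and let $$\mathcal U^{s-1}=\{(f_1,f_2)\in\mathcal S^{s-1}: f_1(x)>0 \text{ and } f_1(x)^2-f_2(x)^2>0 \text{ for all } x\in S^1\},$$ an open subset of $\mathcal S^{s-1}$, with the manifold structure inherited from $\mathcal S^{s-1}$ and the metric induced by $\langle\!\langle\cdot,\cdot\rangle\!\rangle$. Theorem. The map $$\Phi(\varphi,\alpha)=\sqrt{\varphi_x}\,\bigl(\cosh(\alpha/2),\ \sinh(\alpha/2)\bigr)$$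 is a ($C^\infty$) diffeomorphism of $G^s$ onto $\mathcal U^{s-1}$. Its inverse is $$\Phi^{-1}(f)=\Bigl(x\mapsto\int_0^x\bigl(f_1(y)^2-f_2(y)^2\bigr)\,dy,\ \ 2\operatorname{arctanh}\frac{f_2}{f_1}\Bigr),$$ and $\Phi$ is an isometry: $\langle\!\langle d\Phi_{(\varphi,\alpha)}U,\ d\Phi_{(\varphi,\alpha)}V\rangle\!\rangle=\langle U,V\rangle_{(\varphi,\alpha)}$ for all $(\varphi,\alpha)\in G^s$ and $U,V\in T_{(\varphi,\alpha)}G^s=H^s_0(S^1)\times H^{s-1}(S^1)$. -/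

import Mathlib

open scoped Manifold ContDiff Topology

noncomputable section

namespace HunterSaxton

/-! ### Sobolev spaces on the circle -/

/-- The `n`-th Fourier coefficient of a continuous real function on `S¹ = ℝ/ℤ`. -/
def fourierC (f : C(UnitAddCircle, ℝ)) (n : ℤ) : ℂ :=
  fourierCoeff (fun x : UnitAddCircle => (f x : ℂ)) n

theorem integrable_ofReal (f : C(UnitAddCircle, ℝ)) :
    MeasureTheory.Integrable (fun x : UnitAddCircle => (f x : ℂ))
      (AddCircle.haarAddCircle (T := (1 : ℝ))) :=
  (Complex.continuous_ofReal.comp f.continuous).integrable_of_hasCompactSupport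
    (HasCompactSupport.of_compactSpace _)

theorem fourierC_add (f g : C(UnitAddCircle, ℝ)) (n : ℤ) :
    fourierC (f + g) n = fourierC f n + fourierC g n := by
  have h := congrFun (fourierCoeff.add (integrable_ofReal f) (integrable_ofReal g)) n
  rw [Pi.add_apply] at h
  rw [fourierC, fourierC, fourierC, ← h]
  congr 1
  funext x
  simp

theorem fourierC_smul (c : ℝ) (f : C(UnitAddCircle, ℝ)) (n : ℤ) :
    fourierC (c • f) n = c • fourierC f n := by
  have h := fourierCoeff.const_mul (fun x : UnitAddCircle => (f x : ℂ)) (c : ℂ) n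
  rw [fourierC, fourierC, Complex.real_smul, ← h]
  congr 1
  funext x
  simp

/-- The weighted Fourier coefficients `(1 + n²)^{s/2} f̂(n)`. -/
def weighted (s : ℝ) (f : C(UnitAddCircle, ℝ)) (n : ℤ) : ℂ :=
  ((1 + (n : ℝ) ^ 2) ^ (s / 2) : ℝ) • fourierC f n

theorem weighted_add (s : ℝ) (f g : C(UnitAddCircle, ℝ)) :
    weighted s (f + g) = weighted s f + weighted s g := by
  funext n
  simp [weighted, fourierC_add]

theorem weighted_smul (s c : ℝ) (f : C(UnitAddCircle, ℝ)) :
    weighted s (c • f) = c • weighted s f := by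
  funext n
  simp only [weighted, fourierC_smul, Pi.smul_apply]
  rw [smul_comm]

theorem weighted_zero (s : ℝ) : weighted s 0 = 0 := by
  simpa using weighted_smul s 0 0

/-- The real functions `f` on the circle with `∑ (1 + n²)^s |f̂(n)|² < ∞`. For `s > 1/2` every
class in `H^s(S¹) ⊆ L²(S¹)` has exactly one continuous representative, so that for these `s`
this is the space `H^s(S¹)`, each element being given by its continuous representative. -/
def sobolevSubmodule (s : ℝ) : Submodule ℝ C(UnitAddCircle, ℝ) where
  carrier := {f | Memℓp (weighted s f) 2}
  add_mem' {f g} hf hg := by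
    change Memℓp (weighted s (f + g)) 2
    rw [weighted_add]
    exact Memℓp.add hf hg
  zero_mem' := by
    change Memℓp (weighted s 0) 2
    rw [weighted_zero]
    exact zero_memℓp
  smul_mem' c f hf := by
    change Memℓp (weighted s (c • f)) 2
    rw [weighted_smul]
    exact Memℓp.const_smul hf c

/-- The Sobolev space `H^s(S¹)` (`s > 1/2`), with the norm
`‖f‖² = ∑ (1 + n²)^s |f̂(n)|²` (and not with the supremum norm). -/
def Sobolev (s : ℝ) : Type := sobolevSubmodule s

namespace Sobolev

variable {s : ℝ}

instance : AddCommGroup (Sobolev s) := inferInstanceAs (AddCommGroup (sobolevSubmodule s))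

instance : Module ℝ (Sobolev s) := inferInstanceAs (Module ℝ (sobolevSubmodule s))

/-- The underlying continuous function, as a linear map. -/
def toCₗ (s : ℝ) : Sobolev s →ₗ[ℝ] C(UnitAddCircle, ℝ) := (sobolevSubmodule s).subtype

instance : CoeFun (Sobolev s) (fun _ => UnitAddCircle → ℝ) := ⟨fun f => toCₗ s f⟩

theorem memℓp (f : Sobolev s) : Memℓp (weighted s (toCₗ s f)) 2 := f.2

theorem ext {f g : Sobolev s} (h : ∀ x, f x = g x) : f = g :=
  Subtype.ext (ContinuousMap.ext h)

/-- The weighted Fourier transform `H^s(S¹) → ℓ²(ℤ)`, which defines the norm. -/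
def toℓ2 (s : ℝ) : Sobolev s →ₗ[ℝ] lp (fun _ : ℤ => ℂ) 2 where
  toFun f := ⟨weighted s (toCₗ s f), f.memℓp⟩
  map_add' f g := by
    apply Subtype.ext
    change weighted s (toCₗ s (f + g)) = weighted s (toCₗ s f) + weighted s (toCₗ s g)
    rw [map_add, weighted_add]
  map_smul' c f := by
    apply Subtype.ext
    change weighted s (toCₗ s (c • f)) = c • weighted s (toCₗ s f)
    rw [map_smul, weighted_smul]

theorem weight_pos (n : ℤ) (r : ℝ) : 0 < (1 + (n : ℝ) ^ 2) ^ r := by positivity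

theorem toℓ2_injective : Function.Injective (toℓ2 s) := by
  rw [injective_iff_map_eq_zero]
  intro f hf
  have h0 : ∀ n, fourierC (toCₗ s f) n = 0 := by
    intro n
    have h := congrFun (congrArg Subtype.val hf) n
    change ((1 + (n : ℝ) ^ 2) ^ (s / 2) : ℝ) • fourierC (toCₗ s f) n = 0 at h
    exact (smul_eq_zero.1 h).resolve_left (weight_pos n _).ne'
  let F : C(UnitAddCircle, ℂ) := ⟨fun x => (f x : ℂ),
    Complex.continuous_ofReal.comp (toCₗ s f).continuous⟩
  have h1 : fourierCoeff F = 0 := funext h0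
  apply ext
  intro x
  have h2 := has_pointwise_sum_fourier_series_of_summable (f := F) (by rw [h1]; exact summable_zero) x
  simp only [h1, Pi.zero_apply, zero_smul] at h2
  have h3 : (f x : ℂ) = 0 := h2.unique hasSum_zero
  have h4 : f x = 0 := by exact_mod_cast h3
  rw [h4, map_zero]
  rfl

instance : NormedAddCommGroup (Sobolev s) :=
  NormedAddCommGroup.induced (Sobolev s) (lp (fun _ : ℤ => ℂ) 2) (toℓ2 s) toℓ2_injective

instance : NormedSpace ℝ (Sobolev s) :=
  NormedSpace.induced ℝ (Sobolev s) (lp (fun _ : ℤ => ℂ) 2) (toℓ2 s)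

theorem hasSum_norm_sq (f : Sobolev s) :
    HasSum (fun n : ℤ => (1 + (n : ℝ) ^ 2) ^ s * ‖fourierC (toCₗ s f) n‖ ^ 2) (‖f‖ ^ 2) := by
  have h := lp.hasSum_norm (p := 2) (by simp) (toℓ2 s f)
  have e : ‖toℓ2 s f‖ = ‖f‖ := rfl
  rw [e] at h
  simp only [ENNReal.toReal_ofNat, Real.rpow_two] at h
  convert h using 2 with n
  change _ = ‖((1 + (n : ℝ) ^ 2) ^ (s / 2) : ℝ) • fourierC (toCₗ s f) n‖ ^ 2
  rw [norm_smul, mul_pow, Real.norm_of_nonneg (weight_pos n _).le,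
    ← Real.rpow_natCast (_ ^ (s / 2)), ← Real.rpow_mul (by positivity)]
  norm_num

theorem summable_weight {r : ℝ} (hr : 1 / 2 < r) :
    Summable (fun n : ℤ => (1 + (n : ℝ) ^ 2) ^ (-r)) := by
  have h := Real.summable_abs_int_rpow (b := 2 * r) (by linarith)
  refine Summable.of_norm_bounded_eventually h ?_
  filter_upwards [(Set.finite_singleton (0 : ℤ)).compl_mem_cofinite] with n hn
  have hn' : (n : ℝ) ≠ 0 := by exact_mod_cast hn
  rw [Real.norm_of_nonneg (weight_pos n _).le]
  have e : |(n : ℝ)| ^ (-(2 * r)) = ((n : ℝ) ^ 2) ^ (-r) := by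
    rw [← sq_abs, ← Real.rpow_natCast, ← Real.rpow_mul (abs_nonneg _)]
    norm_num
  rw [e]
  exact Real.rpow_le_rpow_of_nonpos (by positivity) (by linarith) (by linarith)

/-- `∑ (1 + n²)^{t/2} |f̂(n)| ≤ C ‖f‖` whenever `s - t > 1/2`. -/
theorem exists_tsum_le {t : ℝ} (h : 1 / 2 < s - t) : ∃ C : ℝ, ∀ f : Sobolev s,
    Summable (fun n : ℤ => (1 + (n : ℝ) ^ 2) ^ (t / 2) * ‖fourierC (toCₗ s f) n‖) ∧
      ∑' n : ℤ, (1 + (n : ℝ) ^ 2) ^ (t / 2) * ‖fourierC (toCₗ s f) n‖ ≤ C * ‖f‖ := by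
  refine ⟨(∑' n : ℤ, (1 + (n : ℝ) ^ 2) ^ (-(s - t))) ^ (1 / (2 : ℝ)), fun f => ?_⟩
  have hw : ∀ n : ℤ, ((1 + (n : ℝ) ^ 2) ^ ((t - s) / 2)) ^ (2 : ℝ)
      = (1 + (n : ℝ) ^ 2) ^ (-(s - t)) := by
    intro n
    rw [← Real.rpow_mul (by positivity)]
    congr 1
    ring
  have hv : ∀ n : ℤ, ((1 + (n : ℝ) ^ 2) ^ (s / 2) * ‖fourierC (toCₗ s f) n‖) ^ (2 : ℝ)
      = (1 + (n : ℝ) ^ 2) ^ s * ‖fourierC (toCₗ s f) n‖ ^ 2 := by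
    intro n
    rw [Real.mul_rpow (by positivity) (norm_nonneg _), ← Real.rpow_mul (by positivity),
      Real.rpow_two]
    congr 2
    ring
  have key := Real.summable_and_inner_le_Lp_mul_Lq_tsum_of_nonneg
    (f := fun n : ℤ => (1 + (n : ℝ) ^ 2) ^ ((t - s) / 2))
    (g := fun n : ℤ => (1 + (n : ℝ) ^ 2) ^ (s / 2) * ‖fourierC (toCₗ s f) n‖)
    (p := 2) (q := 2) (Real.HolderConjugate.two_two) (fun n => by positivity)
    (fun n => by positivity)
    (by simpa only [hw] using summable_weight h)
    (by simpa only [hv] using (hasSum_norm_sq f).summable)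
  simp only [hw, hv, (hasSum_norm_sq f).tsum_eq] at key
  have e : ∀ n : ℤ, (1 + (n : ℝ) ^ 2) ^ ((t - s) / 2) *
      ((1 + (n : ℝ) ^ 2) ^ (s / 2) * ‖fourierC (toCₗ s f) n‖)
      = (1 + (n : ℝ) ^ 2) ^ (t / 2) * ‖fourierC (toCₗ s f) n‖ := by
    intro n
    rw [← mul_assoc, ← Real.rpow_add (by positivity)]
    congr 2
    ring
  simp only [e] at key
  refine ⟨key.1, key.2.trans_eq ?_⟩
  congr 1
  rw [← Real.sqrt_eq_rpow, Real.sqrt_sq (norm_nonneg f)]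

theorem norm_fourier_apply (n : ℤ) (x : UnitAddCircle) : ‖(fourier n x : ℂ)‖ = 1 := by
  rw [fourier_apply]
  exact Circle.norm_coe _

theorem norm_toCₗ_le (h : 1 / 2 < s) : ∃ C : ℝ, ∀ f : Sobolev s, ‖toCₗ s f‖ ≤ C * ‖f‖ := by
  obtain ⟨C, hC⟩ := exists_tsum_le (s := s) (t := 0) (by linarith)
  refine ⟨C, fun f => ?_⟩
  obtain ⟨h1, h2⟩ := hC f
  simp only [zero_div, Real.rpow_zero, one_mul] at h1 h2
  let F : C(UnitAddCircle, ℂ) := ⟨fun x => (f x : ℂ),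
    Complex.continuous_ofReal.comp (toCₗ s f).continuous⟩
  have hF : ∀ n, fourierCoeff F n = fourierC (toCₗ s f) n := fun n => rfl
  have hs : Summable (fourierCoeff F) := Summable.of_norm h1
  rw [ContinuousMap.norm_le _ ((tsum_nonneg fun _ => norm_nonneg _).trans h2)]
  intro x
  have h3 := has_pointwise_sum_fourier_series_of_summable (f := F) hs x
  have h4 : ‖(F x)‖ ≤ ∑' n : ℤ, ‖fourierC (toCₗ s f) n‖ := by
    rw [← h3.tsum_eq]
    refine tsum_of_norm_bounded h1.hasSum fun n => ?_
    rw [norm_smul, hF, norm_fourier_apply, mul_one]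
  have h5 : ‖F x‖ = ‖f x‖ := by
    change ‖((f x : ℝ) : ℂ)‖ = _
    rw [Complex.norm_real]
  exact (h5 ▸ h4).trans h2

/-- The Sobolev embedding `H^s(S¹) → C(S¹)`, `s > 1/2`. -/
def toC (h : 1 / 2 < s) : Sobolev s →L[ℝ] C(UnitAddCircle, ℝ) :=
  (toCₗ s).mkContinuousOfExistsBound (norm_toCₗ_le h)

theorem exists_deriv (h : 3 / 2 < s) : ∃ D : Sobolev s →L[ℝ] C(UnitAddCircle, ℝ),
    ∀ (u : Sobolev s) (x : ℝ), HasDerivAt (fun y : ℝ => u y) (D u x) x := by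
  obtain ⟨C, hC⟩ := exists_tsum_le (s := s) (t := 1) (by linarith)
  let a : Sobolev s → ℤ → ℂ := fun u n => 2 * Real.pi * Complex.I * n * fourierC (toCₗ s u) n
  have ha : ∀ u n, ‖a u n‖ ≤ 2 * Real.pi *
      ((1 + (n : ℝ) ^ 2) ^ ((1 : ℝ) / 2) * ‖fourierC (toCₗ s u) n‖) := by
    intro u n
    have : |(n : ℝ)| ≤ (1 + (n : ℝ) ^ 2) ^ ((1 : ℝ) / 2) := by
      rw [← Real.sqrt_eq_rpow]
      exact Real.abs_le_sqrt (by linarith)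
    simp only [a, norm_mul, Complex.norm_I, Complex.norm_real, Complex.norm_intCast,
      Complex.norm_ofNat, Real.norm_of_nonneg Real.pi_pos.le, mul_one]
    rw [mul_assoc]
    gcongr
  have hfn : ∀ n : ℤ, ‖(fourier n : C(UnitAddCircle, ℂ))‖ = 1 := fun n => fourier_norm n
  have hterm : ∀ u n, ‖a u n • (fourier n : C(UnitAddCircle, ℂ))‖ ≤ 2 * Real.pi *
      ((1 + (n : ℝ) ^ 2) ^ ((1 : ℝ) / 2) * ‖fourierC (toCₗ s u) n‖) := by
    intro u n
    rw [norm_smul, hfn, mul_one]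
    exact ha u n
  have hsum : ∀ u, Summable fun n => a u n • (fourier n : C(UnitAddCircle, ℂ)) := fun u =>
    Summable.of_norm_bounded ((hC u).1.mul_left _) (hterm u)
  let reC : C(UnitAddCircle, ℂ) →L[ℝ] C(UnitAddCircle, ℝ) :=
    Complex.reCLM.compLeftContinuous ℝ UnitAddCircle
  let Dₗ : Sobolev s →ₗ[ℝ] C(UnitAddCircle, ℂ) :=
    { toFun := fun u => ∑' n, a u n • (fourier n : C(UnitAddCircle, ℂ))
      map_add' := by
        intro u v
        rw [← (hsum u).tsum_add (hsum v)]
        congr 1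
        funext n
        rw [show a (u + v) n = a u n + a v n by
          simp only [a, map_add, fourierC_add]
          ring]
        ext x
        simp only [ContinuousMap.add_apply, ContinuousMap.smul_apply, smul_eq_mul]
        ring
      map_smul' := by
        intro c u
        rw [RingHom.id_apply, ← (hsum u).tsum_const_smul]
        congr 1
        funext n
        rw [← smul_assoc]
        congr 1
        simp only [a, map_smul, fourierC_smul, Complex.real_smul]
        ring }
  let D : Sobolev s →L[ℝ] C(UnitAddCircle, ℂ) := Dₗ.mkContinuous (2 * Real.pi * C) (by
    intro u
    have h1 := tsum_of_norm_bounded ((hC u).1.mul_left (2 * Real.pi)).hasSum (hterm u)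
    refine h1.trans ?_
    rw [tsum_mul_left, mul_assoc (2 * Real.pi) C]
    exact mul_le_mul_of_nonneg_left (hC u).2 (by positivity))
  refine ⟨reC.comp D, fun u x => ?_⟩
  obtain ⟨C0, hC0⟩ := exists_tsum_le (s := s) (t := 0) (by linarith)
  have h1 := (hC0 u).1
  simp only [zero_div, Real.rpow_zero, one_mul] at h1
  let F : C(UnitAddCircle, ℂ) := ⟨fun x => (u x : ℂ),
    Complex.continuous_ofReal.comp (toCₗ s u).continuous⟩
  have hF : ∀ n, fourierCoeff F n = fourierC (toCₗ s u) n := fun n => rfl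
  have hsF : Summable (fourierCoeff F) := Summable.of_norm h1
  have h3 := has_pointwise_sum_fourier_series_of_summable (f := F) hsF
  have hd : ∀ (n : ℤ) (y : ℝ), HasDerivAt
      (fun y : ℝ => fourierCoeff F n * fourier n (y : UnitAddCircle))
      (a u n * fourier n (y : UnitAddCircle)) y := by
    intro n y
    have h5 := (hasDerivAt_fourier (1 : ℝ) n y).const_mul (fourierCoeff F n)
    refine h5.congr_deriv ?_
    rw [hF]
    simp only [a]
    push_cast
    ring
  have h4 := hasDerivAt_tsum (𝕜 := ℝ) (F := ℂ)
    (g := fun (n : ℤ) (y : ℝ) => fourierCoeff F n * fourier n (y : UnitAddCircle))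
    (g' := fun (n : ℤ) (y : ℝ) => a u n * fourier n (y : UnitAddCircle))
    ((hC u).1.mul_left (2 * Real.pi))
    hd (fun n y => by
      rw [norm_mul, norm_fourier_apply, mul_one]
      exact ha u n)
    (y₀ := (0 : ℝ)) (h3 ((0 : ℝ) : UnitAddCircle)).summable x
  have h5 : (fun y : ℝ => ∑' n : ℤ, fourierCoeff F n * fourier n (y : UnitAddCircle))
      = fun y : ℝ => ((u y : ℝ) : ℂ) := by
    funext y
    exact (h3 (y : UnitAddCircle)).tsum_eq
  rw [h5] at h4
  have h6 : ∑' n : ℤ, a u n * fourier n (x : UnitAddCircle) = D u x := by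
    change _ = (∑' n, a u n • (fourier n : C(UnitAddCircle, ℂ))) (x : UnitAddCircle)
    rw [← ContinuousMap.tsum_apply (hsum u)]
    rfl
  rw [h6] at h4
  have h7 := (Complex.reCLM.hasFDerivAt (x := ((u x : ℝ) : ℂ))).comp_hasDerivAt x h4
  exact h7

theorem one_mem (s : ℝ) : (1 : C(UnitAddCircle, ℝ)) ∈ sobolevSubmodule s := by
  have h : ∀ n : ℤ, n ≠ 0 → weighted s 1 n = 0 := by
    intro n hn
    have h1 := congrFun (fourierCoeff_fourier (T := 1) 0) n
    have h2 : (fun x : UnitAddCircle => (((1 : C(UnitAddCircle, ℝ)) x : ℝ) : ℂ))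
        = ⇑(fourier (T := (1 : ℝ)) 0) := by
      funext x
      simp
    rw [weighted, fourierC, h2, h1, Pi.single_eq_of_ne hn, smul_zero]
  apply memℓp_gen
  refine summable_of_ne_finset_zero (s := {0}) fun n hn => ?_
  rw [h n (by simpa using hn)]
  simp

/-- The constant function `1`. -/
def one (s : ℝ) : Sobolev s := ⟨1, one_mem s⟩

end Sobolev

end HunterSaxton

namespace HunterSaxton

/-! ### Hyperquadrics as manifolds -/

section Quadric

variable {E : Type*} [NormedAddCommGroup E] [NormedSpace ℝ E]

/-- The hyperplane `B`-orthogonal to `e`. -/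
abbrev orthHyperplane (B : E →L[ℝ] E →L[ℝ] ℝ) (e : E) : Submodule ℝ E := (B e).ker

/-- The stereographic projection `f ↦ (1 - σ B(e,f))⁻¹ (f - B(e,f) e)`. -/
def stereoTo (B : E →L[ℝ] E →L[ℝ] ℝ) (e : E) (he : B e e = 1) (σ : ℝ) (f : E) :
    orthHyperplane B e :=
  (1 - σ * B e f)⁻¹ • ⟨f - B e f • e, by simp [he]⟩

/-- The inverse of the stereographic projection, `v ↦ t v + (1 - t) σ e` with
`t = 2 / (1 + B(v,v))`. -/
def stereoInv (B : E →L[ℝ] E →L[ℝ] ℝ) (e : E) (σ : ℝ) (v : E) : E :=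
  (2 * (1 + B v v)⁻¹) • v + ((1 - 2 * (1 + B v v)⁻¹) * σ) • e

theorem stereoInv_form {B : E →L[ℝ] E →L[ℝ] ℝ} (hB : ∀ f g, B f g = B g f) {e : E}
    (he : B e e = 1) {σ : ℝ} (hσ : σ * σ = 1) {v : E} (hv : B e v = 0) (hv' : 1 + B v v ≠ 0) :
    B e (stereoInv B e σ v) = (1 - 2 * (1 + B v v)⁻¹) * σ ∧
      B (stereoInv B e σ v) (stereoInv B e σ v) = 1 := by
  have hv2 : B v e = 0 := by rw [hB, hv]
  constructor
  · simp [stereoInv, hv, he]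
  · simp only [stereoInv, map_add, map_smul, add_apply,
      smul_apply, smul_eq_mul, hv, hv2, he]
    have : σ ^ 2 = 1 := by rw [sq, hσ]
    field_simp
    ring_nf
    rw [this]
    ring

theorem stereoTo_form {B : E →L[ℝ] E →L[ℝ] ℝ} (hB : ∀ f g, B f g = B g f) {e : E}
    (he : B e e = 1) {σ : ℝ} (hσ : σ * σ = 1) {f : E} (hf : B f f = 1)
    (hf' : 1 - σ * B e f ≠ 0) :
    1 + B (stereoTo B e he σ f : E) (stereoTo B e he σ f : E) = 2 * (1 - σ * B e f)⁻¹ := by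
  have h2 : B f e = B e f := hB _ _
  simp only [stereoTo, Submodule.coe_smul, map_smul, map_sub, sub_apply,
      smul_apply, smul_eq_mul, hf, h2, he]
  have : σ ^ 2 = 1 := by rw [sq, hσ]
  field_simp
  ring_nf
  rw [this]
  ring

/-- Stereographic projection of `S = {f | B(f,f) = 1}` from the pole `σ e`, `σ = ±1`, onto the
hyperplane `B(e,·) = 0`; its domain is `{f ∈ S | σ B(e,f) ≠ 1}`. -/
def stereo (B : E →L[ℝ] E →L[ℝ] ℝ) (hB : ∀ f g, B f g = B g f) (S : Set E)
    (hS : ∀ f, f ∈ S ↔ B f f = 1) (e : E) (he : B e e = 1) (σ : ℝ) (hσ : σ * σ = 1) :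
    OpenPartialHomeomorph S (orthHyperplane B e) where
  toFun f := stereoTo B e he σ f
  invFun v :=
    haveI := Classical.dec (1 + B (v : E) v = 0)
    if h : 1 + B (v : E) v = 0 then ⟨e, (hS e).2 he⟩ else
      ⟨stereoInv B e σ v, (hS _).2 (stereoInv_form hB he hσ v.2 h).2⟩
  source := {f | 1 - σ * B e (f : E) ≠ 0}
  target := {v | 1 + B (v : E) v ≠ 0}
  map_source' := by
    intro f hf
    change 1 + B (stereoTo B e he σ (f : E) : E) (stereoTo B e he σ (f : E) : E) ≠ 0
    rw [stereoTo_form hB he hσ ((hS _).1 f.2) hf]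
    exact mul_ne_zero two_ne_zero (inv_ne_zero hf)
  map_target' := by
    intro v hv
    have hv' : 1 + B (v : E) v ≠ 0 := hv
    change 1 - σ * B e _ ≠ 0
    rw [dif_neg hv', (stereoInv_form hB he hσ v.2 hv').1]
    have : 1 - σ * ((1 - 2 * (1 + B (v : E) v)⁻¹) * σ) = 2 * (1 + B (v : E) v)⁻¹ := by
      linear_combination (2 * (1 + B (v : E) v)⁻¹ - 1) * hσ
    rw [this]
    exact mul_ne_zero two_ne_zero (inv_ne_zero hv')
  left_inv' := by
    intro f hf
    have hf' : 1 - σ * B e (f : E) ≠ 0 := hf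
    have h1 := stereoTo_form hB he hσ ((hS _).1 f.2) hf'
    have h2 : 1 + B (stereoTo B e he σ (f : E) : E) (stereoTo B e he σ (f : E) : E) ≠ 0 := by
      rw [h1]
      exact mul_ne_zero two_ne_zero (inv_ne_zero hf')
    rw [dif_neg h2]
    apply Subtype.ext
    change stereoInv B e σ _ = _
    rw [stereoInv, h1]
    have h3 : 2 * (2 * (1 - σ * B e (f : E))⁻¹)⁻¹ = 1 - σ * B e (f : E) := by
      field_simp
    rw [h3, stereoTo, Submodule.coe_smul, smul_smul, mul_inv_cancel₀ hf', one_smul]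
    have h4 : (1 - (1 - σ * B e (f : E))) * σ = B e (f : E) := by
      linear_combination (B e (f : E)) * hσ
    rw [h4, sub_add_cancel]
  right_inv' := by
    intro v hv
    have hv' : 1 + B (v : E) v ≠ 0 := hv
    rw [dif_neg hv']
    apply Subtype.ext
    change ((stereoTo B e he σ (stereoInv B e σ v) : orthHyperplane B e) : E) = v
    change (1 - σ * B e (stereoInv B e σ v))⁻¹ •
      (stereoInv B e σ v - B e (stereoInv B e σ v) • e) = (v : E)
    rw [(stereoInv_form hB he hσ v.2 hv').1]
    have : 1 - σ * ((1 - 2 * (1 + B (v : E) v)⁻¹) * σ) = 2 * (1 + B (v : E) v)⁻¹ := by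
      linear_combination (2 * (1 + B (v : E) v)⁻¹ - 1) * hσ
    rw [this, stereoInv, add_sub_cancel_right, smul_smul,
      inv_mul_cancel₀ (mul_ne_zero two_ne_zero (inv_ne_zero hv')), one_smul]
  open_source := by
    have : Continuous fun f : S => 1 - σ * B e (f : E) := by fun_prop
    exact isOpen_ne.preimage this
  open_target := by
    have : Continuous fun v : orthHyperplane B e => 1 + B (v : E) v := by fun_prop
    exact isOpen_ne.preimage this
  continuousOn_toFun := by
    refine ContinuousOn.smul (ContinuousOn.inv₀ (by fun_prop) fun f hf => hf) ?_
    exact Continuous.continuousOn (Continuous.subtype_mk (by fun_prop) _)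
  continuousOn_invFun := by
    rw [continuousOn_iff_continuous_domRestrict]
    refine continuous_induced_rng.2 ?_
    have h : Continuous fun v : {v : orthHyperplane B e | 1 + B (v : E) v ≠ 0} =>
        stereoInv B e σ (v : orthHyperplane B e) := by
      unfold stereoInv
      have h1 : Continuous fun v : {v : orthHyperplane B e | 1 + B (v : E) v ≠ 0} =>
          (1 + B ((v : orthHyperplane B e) : E) (v : orthHyperplane B e))⁻¹ :=
        Continuous.inv₀ (by fun_prop) fun v => v.2
      fun_prop
    refine h.congr fun v => ?_
    have hv : ¬ (1 + B ((v : orthHyperplane B e) : E) (v : orthHyperplane B e) = 0) := v.2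
    simp only [Function.comp_apply, Set.domRestrict_apply, dif_neg hv]

variable (B : E →L[ℝ] E →L[ℝ] ℝ) (hB : ∀ f g, B f g = B g f) (S : Set E)
    (hS : ∀ f, f ∈ S ↔ B f f = 1) (e : E) (he : B e e = 1)

/-- The two stereographic projections, from `e` and from `-e`, are an atlas of
`S = {f | B(f,f) = 1}`. -/
abbrev quadricChartedSpace : ChartedSpace (orthHyperplane B e) S where
  atlas := {stereo B hB S hS e he 1 (by norm_num), stereo B hB S hS e he (-1) (by norm_num)}
  chartAt f :=
    haveI := Classical.dec (B e (f : E) = 1)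
    if B e (f : E) = 1 then stereo B hB S hS e he (-1) (by norm_num)
    else stereo B hB S hS e he 1 (by norm_num)
  mem_chart_source f := by
    split_ifs with h
    · change 1 - (-1) * B e (f : E) ≠ 0
      rw [h]
      norm_num
    · change 1 - 1 * B e (f : E) ≠ 0
      rw [one_mul]
      exact sub_ne_zero.2 (Ne.symm h)
  chart_mem_atlas f := by
    split_ifs
    · exact Or.inr rfl
    · exact Or.inl rfl

theorem contDiffOn_stereoInv (n : ℕ∞ω) (σ : ℝ) : ContDiffOn ℝ n
    (fun v : orthHyperplane B e => stereoInv B e σ v) {v | 1 + B (v : E) v ≠ 0} := by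
  unfold stereoInv
  have h0 : ContDiff ℝ n fun v : orthHyperplane B e => (v : E) :=
    (orthHyperplane B e).subtypeL.contDiff
  have h1 : ContDiffOn ℝ n (fun v : orthHyperplane B e => (1 + B (v : E) v)⁻¹)
      {v | 1 + B (v : E) v ≠ 0} := by
    refine ContDiffOn.inv (ContDiff.contDiffOn ?_) fun v hv => hv
    exact contDiff_const.add ((B.contDiff.comp h0).clm_apply h0)
  exact ((contDiffOn_const.mul h1).smul h0.contDiffOn).add
    (((contDiffOn_const.sub (contDiffOn_const.mul h1)).mul contDiffOn_const).smul
      contDiffOn_const)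

theorem contDiffOn_stereoTo (n : ℕ∞ω) (σ : ℝ) : ContDiffOn ℝ n
    (fun f : E => stereoTo B e he σ f) {f | 1 - σ * B e f ≠ 0} := by
  unfold stereoTo
  refine ContDiffOn.smul (ContDiffOn.inv (ContDiff.contDiffOn ?_) fun v hv => hv)
    (ContDiff.contDiffOn ?_)
  · exact contDiff_const.sub (contDiff_const.mul (B e).contDiff)
  · let P : E →L[ℝ] orthHyperplane B e :=
      (ContinuousLinearMap.id ℝ E - (B e).smulRight e).codRestrict _ (by
        intro f
        simp [he])
    exact P.contDiff

theorem quadric_isManifold (n : ℕ∞ω) :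
    letI := quadricChartedSpace B hB S hS e he
    IsManifold 𝓘(ℝ, orthHyperplane B e) n S := by
  let _ := quadricChartedSpace B hB S hS e he
  have key : ∀ (σ τ : ℝ) (hσ : σ * σ = 1) (hτ : τ * τ = 1),
      ContDiffOn ℝ n (stereo B hB S hS e he τ hτ ∘ (stereo B hB S hS e he σ hσ).symm)
        ((stereo B hB S hS e he σ hσ).symm ≫ₕ stereo B hB S hS e he τ hτ).source := by
    intro σ τ hσ hτ
    have hinv : ∀ v : orthHyperplane B e, 1 + B (v : E) v ≠ 0 →
        (((stereo B hB S hS e he σ hσ).symm v : S) : E) = stereoInv B e σ v := by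
      intro v hv
      change ((dite _ _ _ : S) : E) = _
      rw [dif_neg hv]
    have h := (contDiffOn_stereoTo B e he n τ).comp_inter (contDiffOn_stereoInv B e n σ)
    refine (h.congr_mono (f₁ := stereo B hB S hS e he τ hτ ∘ (stereo B hB S hS e he σ hσ).symm)
      (s₁ := ((stereo B hB S hS e he σ hσ).symm ≫ₕ stereo B hB S hS e he τ hτ).source) ?_ ?_)
    · intro v hv
      have hv1 : 1 + B (v : E) v ≠ 0 := hv.1
      change stereoTo B e he τ _ = stereoTo B e he τ _
      rw [hinv v hv1]
    · intro v hv
      have hv1 : 1 + B (v : E) v ≠ 0 := hv.1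
      refine ⟨hv1, ?_⟩
      have hv2 : 1 - τ * B e (((stereo B hB S hS e he σ hσ).symm v : S) : E) ≠ 0 := hv.2
      rw [hinv v hv1] at hv2
      exact hv2
  refine isManifold_of_contDiffOn _ _ _ ?_
  intro c c' hc hc'
  simp only [modelWithCornersSelf_coe, modelWithCornersSelf_coe_symm, Set.range_id, Set.inter_univ,
    Function.comp_id, Function.id_comp, Set.preimage_id]
  rcases hc with rfl | rfl <;> rcases hc' with rfl | rfl <;> exact key _ _ _ _

/-- The inclusion `S → E` is smooth. -/
theorem quadric_contMDiff_coe (n : ℕ∞ω) :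
    letI := quadricChartedSpace B hB S hS e he
    ContMDiff 𝓘(ℝ, orthHyperplane B e) 𝓘(ℝ, E) n (Subtype.val : S → E) := by
  let _ := quadricChartedSpace B hB S hS e he
  have := quadric_isManifold B hB S hS e he n
  rw [contMDiff_iff]
  refine ⟨continuous_subtype_val, fun x y => ?_⟩
  have key : ∀ (σ : ℝ) (hσ : σ * σ = 1), ContDiffOn ℝ n
      (Subtype.val ∘ (stereo B hB S hS e he σ hσ).symm) {v | 1 + B (v : E) v ≠ 0} := by
    intro σ hσ
    refine (contDiffOn_stereoInv B e n σ).congr fun v hv => ?_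
    change ((dite _ _ _ : S) : E) = _
    rw [dif_neg hv]
  have key' : ∀ c ∈ atlas (orthHyperplane B e) S,
      ContDiffOn ℝ n (Subtype.val ∘ c.symm) c.target := by
    rintro c (rfl | rfl) <;> exact key _ _
  simp only [extChartAt, mfld_simps]
  exact (key' _ (chart_mem_atlas _ x)).mono Set.inter_subset_left

/-- A smooth map to `E` with values in `S` is smooth as a map to `S`. -/
theorem quadric_contMDiff_codRestrict (n : ℕ∞ω) {F H M : Type*} [NormedAddCommGroup F]
    [NormedSpace ℝ F] [TopologicalSpace H] {I : ModelWithCorners ℝ F H} [TopologicalSpace M]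
    [ChartedSpace H M] [IsManifold I n M] (φ : M → S) (hφ : ContMDiff I 𝓘(ℝ, E) n fun x => (φ x : E)) :
    letI := quadricChartedSpace B hB S hS e he
    ContMDiff I 𝓘(ℝ, orthHyperplane B e) n φ := by
  let _ := quadricChartedSpace B hB S hS e he
  have := quadric_isManifold B hB S hS e he n
  rw [contMDiff_iff_target]
  refine ⟨continuous_induced_rng.2 hφ.continuous, fun y => ?_⟩
  have key : ∀ (σ : ℝ) (hσ : σ * σ = 1), ContMDiffOn I 𝓘(ℝ, orthHyperplane B e) n
      (stereo B hB S hS e he σ hσ ∘ φ) (φ ⁻¹' (stereo B hB S hS e he σ hσ).source) := by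
    intro σ hσ
    exact (contDiffOn_stereoTo B e he n σ).contMDiffOn.comp hφ.contMDiffOn fun x hx => hx
  have key' : ∀ c ∈ atlas (orthHyperplane B e) S,
      ContMDiffOn I 𝓘(ℝ, orthHyperplane B e) n (c ∘ φ) (φ ⁻¹' c.source) := by
    rintro c (rfl | rfl) <;> exact key _ _
  simp only [extChartAt, mfld_simps]
  exact key' _ (chart_mem_atlas _ y)
end Quadric

/-! ### The pseudosphere -/

/-- The real Hilbert space `L²(S¹)`. -/
abbrev L2 : Type := MeasureTheory.Lp ℝ 2 (MeasureTheory.volume : MeasureTheory.Measure UnitAddCircle)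

/-- The indefinite scalar product `⟪⟪X, Y⟫⟫ = ∫ (X₁ Y₁ - X₂ Y₂) dx` on `L²(S¹; ℝ²)`. -/
def lorentz (X Y : L2 × L2) : ℝ := ∫ x : UnitAddCircle, (X.1 x * Y.1 x - X.2 x * Y.2 x)

/-- The unit pseudosphere in `L²(S¹; ℝ²)`. -/
def pseudosphereL2 : Set (L2 × L2) := {X | lorentz X X = 1}

/-- The inclusion of `H^s(S¹; ℝ²)` in `L²(S¹; ℝ²)`. -/
def toL2 {s : ℝ} (f : Sobolev s × Sobolev s) : L2 × L2 :=
  (ContinuousMap.toLp 2 MeasureTheory.volume ℝ (Sobolev.toCₗ s f.1),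
    ContinuousMap.toLp 2 MeasureTheory.volume ℝ (Sobolev.toCₗ s f.2))

/-- The pseudosphere `𝒮^s`: the elements of the unit pseudosphere of Sobolev class `H^s`. -/
def Pseudosphere (s : ℝ) (_hs : 1 / 2 < s) : Type :=
  {f : Sobolev s × Sobolev s | toL2 f ∈ pseudosphereL2}

theorem lorentz_eq (X Y : L2 × L2) : lorentz X Y = inner ℝ X.1 Y.1 - inner ℝ X.2 Y.2 := by
  have h := fun f g : L2 => MeasureTheory.L2.integrable_inner (𝕜 := ℝ) f g
  rw [MeasureTheory.L2.inner_def, MeasureTheory.L2.inner_def,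
    ← MeasureTheory.integral_sub (h _ _) (h _ _), lorentz]
  simp [mul_comm]

section

variable {s : ℝ} (hs : 1 / 2 < s)

/-- `toL2` as a continuous linear map. -/
def toL2L : (Sobolev s × Sobolev s) →L[ℝ] (L2 × L2) :=
  ((ContinuousMap.toLp 2 MeasureTheory.volume ℝ).comp (Sobolev.toC hs)).prodMap
    ((ContinuousMap.toLp 2 MeasureTheory.volume ℝ).comp (Sobolev.toC hs))

theorem toL2L_apply (f : Sobolev s × Sobolev s) : toL2L hs f = toL2 f := rfl

/-- The indefinite scalar product on `H^s(S¹; ℝ²)`. -/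
def lorentzL : (Sobolev s × Sobolev s) →L[ℝ] (Sobolev s × Sobolev s) →L[ℝ] ℝ :=
  ContinuousLinearMap.bilinearComp (innerSL ℝ)
      ((ContinuousLinearMap.fst ℝ L2 L2).comp (toL2L hs))
      ((ContinuousLinearMap.fst ℝ L2 L2).comp (toL2L hs)) -
    ContinuousLinearMap.bilinearComp (innerSL ℝ)
      ((ContinuousLinearMap.snd ℝ L2 L2).comp (toL2L hs))
      ((ContinuousLinearMap.snd ℝ L2 L2).comp (toL2L hs))

theorem lorentzL_apply (f g : Sobolev s × Sobolev s) :
    lorentzL hs f g = lorentz (toL2 f) (toL2 g) := by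
  rw [lorentz_eq]
  rfl

theorem lorentzL_symm (f g : Sobolev s × Sobolev s) : lorentzL hs f g = lorentzL hs g f := by
  rw [lorentzL_apply, lorentzL_apply, lorentz_eq, lorentz_eq, real_inner_comm,
    real_inner_comm (toL2 f).2]

/-- The point `(1, 0)` of the pseudosphere. -/
def basePoint (s : ℝ) : Sobolev s × Sobolev s := (Sobolev.one s, 0)

theorem lorentzL_basePoint : lorentzL hs (basePoint s) (basePoint s) = 1 := by
  rw [lorentzL_apply, lorentz]
  have h1 := ContinuousMap.coeFn_toLp (p := 2) (𝕜 := ℝ)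
    (MeasureTheory.volume : MeasureTheory.Measure UnitAddCircle) (Sobolev.toCₗ s (Sobolev.one s))
  have h2 := ContinuousMap.coeFn_toLp (p := 2) (𝕜 := ℝ)
    (MeasureTheory.volume : MeasureTheory.Measure UnitAddCircle) (Sobolev.toCₗ s (0 : Sobolev s))
  have h3 : (fun x : UnitAddCircle => ((toL2 (basePoint s)).1 x * (toL2 (basePoint s)).1 x -
      (toL2 (basePoint s)).2 x * (toL2 (basePoint s)).2 x)) =ᵐ[MeasureTheory.volume]
      fun _ => (1 : ℝ) := by
    filter_upwards [h1, h2] with x hx1 hx2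
    simp only [toL2, basePoint]
    rw [hx1, hx2]
    change (1 : ℝ) * 1 - _ = 1
    simp
  rw [MeasureTheory.integral_congr_ae h3]
  simp [MeasureTheory.measureReal_def]

end

/-- The model space `{(f₁, f₂) ∈ H^s(S¹; ℝ²) | ∫ f₁ dx = 0}` of the pseudosphere. -/
abbrev PseudosphereModel (s : ℝ) (hs : 1 / 2 < s) : Type :=
  orthHyperplane (lorentzL hs) (basePoint s)

namespace Pseudosphere

variable {s : ℝ} {hs : 1 / 2 < s}

instance : TopologicalSpace (Pseudosphere s hs) :=
  inferInstanceAs (TopologicalSpace {f : Sobolev s × Sobolev s | toL2 f ∈ pseudosphereL2})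

/-- The inclusion of `𝒮^s` in `H^s(S¹; ℝ²)`. -/
def incl (f : Pseudosphere s hs) : Sobolev s × Sobolev s := f.1

/-- The manifold structure of `𝒮^s` as a submanifold of `H^s(S¹; ℝ²)`, given by the two
stereographic projections from `(1, 0)` and `(-1, 0)`. -/
instance : ChartedSpace (PseudosphereModel s hs) (Pseudosphere s hs) :=
  quadricChartedSpace (lorentzL hs) (lorentzL_symm hs)
    {f : Sobolev s × Sobolev s | toL2 f ∈ pseudosphereL2}
    (fun f => by rw [lorentzL_apply]; rfl) (basePoint s) (lorentzL_basePoint hs)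

instance (n : ℕ∞ω) : IsManifold 𝓘(ℝ, PseudosphereModel s hs) n (Pseudosphere s hs) :=
  quadric_isManifold (lorentzL hs) (lorentzL_symm hs)
    {f : Sobolev s × Sobolev s | toL2 f ∈ pseudosphereL2}
    (fun f => by rw [lorentzL_apply]; rfl) (basePoint s) (lorentzL_basePoint hs) n

theorem continuous_incl : Continuous (incl : Pseudosphere s hs → _) := continuous_subtype_val

end Pseudosphere

/-- The open subset `𝒰^s = {f₁ > 0, f₁² - f₂² > 0}` of `𝒮^s`. -/
def pseudosphereU (s : ℝ) (hs : 1 / 2 < s) : TopologicalSpace.Opens (Pseudosphere s hs) where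
  carrier := {f | ∀ x : UnitAddCircle,
    0 < f.incl.1 x ∧ 0 < f.incl.1 x ^ 2 - f.incl.2 x ^ 2}
  is_open' := by
    have hopen : IsOpen {F : C(UnitAddCircle, ℝ) × C(UnitAddCircle, ℝ) |
        (∀ x, 0 < F.1 x) ∧ ∀ x, 0 < (F.1 ^ 2 - F.2 ^ 2) x} := by
      have h : IsOpen {F : C(UnitAddCircle, ℝ) | Set.MapsTo F Set.univ (Set.Ioi 0)} :=
        ContinuousMap.isOpen_setOfPred_mapsTo isCompact_univ isOpen_Ioi
      have h1 := h.preimage (continuous_fst : Continuous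
        (Prod.fst : C(UnitAddCircle, ℝ) × C(UnitAddCircle, ℝ) → _))
      have h2 := h.preimage (show Continuous fun F : C(UnitAddCircle, ℝ) × C(UnitAddCircle, ℝ) =>
        F.1 ^ 2 - F.2 ^ 2 by fun_prop)
      convert h1.inter h2 using 1
      ext F
      simp [Set.MapsTo]
    have hc : Continuous fun f : Pseudosphere s hs =>
        (Sobolev.toC hs f.incl.1, Sobolev.toC hs f.incl.2) :=
      (((Sobolev.toC hs).continuous.comp continuous_fst).comp Pseudosphere.continuous_incl).prodMk
        (((Sobolev.toC hs).continuous.comp continuous_snd).comp Pseudosphere.continuous_incl)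
    convert hopen.preimage hc using 1
    ext f
    exact forall_and

/-! ### The group `G^s` -/

/-- `H_0^s(S¹) = {u ∈ H^s(S¹) | u(0) = 0}`. -/
def Sobolev0 (s : ℝ) : Submodule ℝ (Sobolev s) where
  carrier := {u | u 0 = 0}
  add_mem' {u v} hu hv := by
    change Sobolev.toCₗ s (u + v) 0 = 0
    rw [map_add, ContinuousMap.add_apply]
    exact (congrArg₂ (· + ·) hu hv).trans (add_zero 0)
  zero_mem' := by
    change Sobolev.toCₗ s 0 0 = 0
    rw [LinearMap.map_zero]
    rfl
  smul_mem' c u hu := by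
    change Sobolev.toCₗ s (c • u) 0 = 0
    rw [LinearMap.map_smul, ContinuousMap.smul_apply]
    exact (congrArg (c • ·) hu).trans (smul_zero c)

/-- Pairs of real functions on the universal cover `ℝ` of the circle. -/
abbrev FunPair : Type := (ℝ → ℝ) × (ℝ → ℝ)

/-- The lift to `ℝ` of the pair `(id + u, α)`. -/
def liftG {s : ℝ} (g : Sobolev0 s × Sobolev (s - 1)) : FunPair :=
  (fun x => x + (g.1 : Sobolev s) x, fun x => g.2 x)

/-- The lift to `ℝ` of a tangent vector `(U₁, U₂)`. -/
def liftT {s : ℝ} (X : Sobolev0 s × Sobolev (s - 1)) : FunPair :=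
  (fun x => (X.1 : Sobolev s) x, fun x => X.2 x)

/-- `G^s = Diff_0^s(S¹) ⋉ H^{s-1}(S¹)` as a manifold. An orientation preserving diffeomorphism of
the circle of class `H^s` with `φ(0) = 0` has a unique lift `φ : ℝ → ℝ` with `φ(0) = 0`; the lifts
are the functions `φ = id + u` with `u ∈ H_0^s(S¹)` and `φ_x > 0` (for `s > 3/2` these are `C¹`).
So `G^s` is the open set of all `(u, α) ∈ H_0^s(S¹) × H^{s-1}(S¹)` with `(id + u)_x > 0`. -/
def G (s : ℝ) (hs : 5 / 2 < s) : TopologicalSpace.Opens (Sobolev0 s × Sobolev (s - 1)) where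
  carrier := {g | ∀ x : ℝ, 0 < deriv (liftG g).1 x}
  is_open' := by
    obtain ⟨D, hD⟩ := Sobolev.exists_deriv (s := s) (by linarith)
    have h : IsOpen {F : C(UnitAddCircle, ℝ) | Set.MapsTo F Set.univ (Set.Ioi (-1))} :=
      ContinuousMap.isOpen_setOfPred_mapsTo isCompact_univ isOpen_Ioi
    have hc : Continuous fun g : Sobolev0 s × Sobolev (s - 1) => D (g.1 : Sobolev s) := by
      fun_prop
    convert h.preimage hc using 1
    ext g
    have hd : ∀ x : ℝ, deriv (liftG g).1 x = 1 + D (g.1 : Sobolev s) x := fun x =>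
      ((hasDerivAt_id x).add (hD (g.1 : Sobolev s) x)).deriv
    change (∀ x : ℝ, 0 < deriv (liftG g).1 x) ↔ ∀ ⦃x : UnitAddCircle⦄, x ∈ Set.univ →
      -1 < D (g.1 : Sobolev s) x
    simp only [hd]
    constructor
    · intro h x _
      induction x using QuotientAddGroup.induction_on with
      | H x => exact by have := h x; change -1 < D (g.1 : Sobolev s) (x : UnitAddCircle); linarith
    · intro h x
      have := h (x := (x : UnitAddCircle)) trivial
      linarith

/-- The multiplication `(φ, α)(ψ, β) = (φ ∘ ψ, β + α ∘ ψ)` of the semidirect product. -/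
def semidirectMul (g h : FunPair) : FunPair := (g.1 ∘ h.1, h.2 + g.2 ∘ h.1)

/-- The inverse `(φ, α)⁻¹ = (φ⁻¹, -α ∘ φ⁻¹)` in the semidirect product. -/
def semidirectInv (g : FunPair) : FunPair :=
  (Function.invFun g.1, -(g.2 ∘ Function.invFun g.1))

/-- The image of the tangent vector `X` at `g` under the differential of the right translation
`h ↦ h g⁻¹`, a tangent vector at the identity. -/
def rightTranslate (g X : FunPair) : FunPair :=
  (fun x => deriv (fun t : ℝ => (semidirectMul (g + t • X) (semidirectInv g)).1 x) 0,
    fun x => deriv (fun t : ℝ => (semidirectMul (g + t • X) (semidirectInv g)).2 x) 0)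

theorem rightTranslate_eq (g X : FunPair) : rightTranslate g X =
    (X.1 ∘ Function.invFun g.1, X.2 ∘ Function.invFun g.1) := by
  ext x <;> simp [rightTranslate, semidirectMul, semidirectInv]

/-- The metric `¼ ∫ (u₁ₓ v₁ₓ + κ u₂ v₂) dx` at the identity. -/
def metricId (κ : ℝ) (u v : FunPair) : ℝ :=
  1 / 4 * ∫ x in (0 : ℝ)..1, (deriv u.1 x * deriv v.1 x + κ * (u.2 x * v.2 x))

/-- The right-invariant metric on `G^s` with parameter `κ`, evaluated at `g` on the tangent
vectors `X, Y ∈ T_g G^s = H_0^s(S¹) × H^{s-1}(S¹)`. -/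
def metricG (κ : ℝ) {s : ℝ} {hs : 5 / 2 < s} (g : G s hs)
    (X Y : TangentSpace 𝓘(ℝ, Sobolev0 s × Sobolev (s - 1)) g) : ℝ :=
  metricId κ (rightTranslate (liftG (g : Sobolev0 s × Sobolev (s - 1))) (liftT X))
    (rightTranslate (liftG (g : Sobolev0 s × Sobolev (s - 1))) (liftT Y))

/-- The inclusion of `𝒰^s` in `H^s(S¹; ℝ²)`. -/
def inclU {s : ℝ} {hs : 1 / 2 < s} (f : pseudosphereU s hs) : Sobolev s × Sobolev s :=
  (f : Pseudosphere s hs).incl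

/-- The metric on `𝒰^s` induced by the indefinite scalar product of `L²(S¹; ℝ²)`. -/
def metricU {s : ℝ} {hs : 1 / 2 < s} (f : pseudosphereU s hs)
    (X Y : TangentSpace 𝓘(ℝ, PseudosphereModel s hs) f) : ℝ :=
  lorentz
    (toL2 (mfderiv 𝓘(ℝ, PseudosphereModel s hs) 𝓘(ℝ, Sobolev s × Sobolev s) inclU f X))
    (toL2 (mfderiv 𝓘(ℝ, PseudosphereModel s hs) 𝓘(ℝ, Sobolev s × Sobolev s) inclU f Y))

theorem half_lt_sub_one {s : ℝ} (hs : 5 / 2 < s) : 1 / 2 < s - 1 := by linarith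

end HunterSaxton

end

open HunterSaxton

noncomputable section

namespace HunterSaxton

/-! ### Completeness of the Sobolev spaces -/

/-! Algebraically everything comes from `cosh² - sinh² = 1`. For `f = Φ(φ, α)` it gives `f₁² - f₂² =
φ_x`, whose integral over a period is `φ(1) - φ(0) = 1`, so `f` lies on the pseudosphere;
integrating it recovers `φ`. Moreover `f₁ ± f₂ = √φ_x e^{±α/2}`, so `α = log(f₁ + f₂) - log(f₁ -
f₂)`. In the isometry the cross terms cancel by the same identity, and the substitution `y = φ(x)`
turns the right-invariant metric into the resulting integral.

The analytic content is smoothness of these formulas on Sobolev spaces. Both are built from linear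
maps, products, `exp` and `log` on `H^{s-1}`: the square root and the hyperbolic functions are
absorbed in `exp((log φ_x ± α)/2)`. The exponential is the operator exponential of multiplication by
`f`, applied to `1`; working with operators uses only that multiplication is a bounded bilinear map
(`mulL`).

For the logarithm the essential point is that multiplication by a positive function is invertible
(`isUnit_mulL`). After rescaling, this concerns `1 - g` with `|g| ≤ ρ < 1`, where only the supremum
of `g` is small, not its Sobolev norm. The tame estimate `‖fg‖ ≤ C(‖g‖ w(f) + ‖f‖ w(g))`, with the
Wiener norm `w`, closes this gap: `w(g^k) → 0` because `w` is controlled by the `C¹` norm, and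
repeated squaring then makes `‖g^(2^k)‖` small. This is where `s - 1 > 3/2` enters. An integral
formula now places `log f` in the same space, and the inverse function theorem applied to `exp`
makes it smooth (`contDiffAt_log`).

Continuity of differentiation and integration between Sobolev spaces comes from the closed graph
theorem (`continuous_of_eval`). -/

theorem norm_fourierC_le (f : C(UnitAddCircle, ℝ)) (n : ℤ) : ‖fourierC f n‖ ≤ ‖f‖ := by
  rw [fourierC, fourierCoeff]
  refine (MeasureTheory.norm_integral_le_of_norm_le_const (C := ‖f‖) ?_).trans_eq (by simp)
  refine Filter.Eventually.of_forall fun x => ?_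
  rw [norm_smul, Sobolev.norm_fourier_apply, one_mul, Complex.norm_real]
  exact f.norm_coe_le_norm x

/-- The `n`-th Fourier coefficient as a continuous linear functional. -/
def fourierCL (n : ℤ) : C(UnitAddCircle, ℝ) →L[ℝ] ℂ :=
  LinearMap.mkContinuous
    { toFun := fun f => fourierC f n
      map_add' := fun f g => fourierC_add f g n
      map_smul' := fun c f => fourierC_smul c f n } 1
    fun f => by simpa using norm_fourierC_le f n

namespace Sobolev

variable {s : ℝ}

theorem mem_sobolevSubmodule_iff {f : C(UnitAddCircle, ℝ)} : f ∈ sobolevSubmodule s ↔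
    Summable fun n : ℤ => (1 + (n : ℝ) ^ 2) ^ s * ‖fourierC f n‖ ^ 2 := by
  change Memℓp (weighted s f) 2 ↔ _
  rw [memℓp_gen_iff (by simp)]
  refine summable_congr fun n => ?_
  simp only [weighted, norm_smul, ENNReal.toReal_ofNat, Real.rpow_two, mul_pow]
  rw [Real.norm_of_nonneg (weight_pos n _).le, ← Real.rpow_natCast (_ ^ (s / 2)),
    ← Real.rpow_mul (by positivity)]
  norm_num

/-- The evaluation functional at `x`. -/
def eval (h : 1 / 2 < s) (x : UnitAddCircle) : Sobolev s →L[ℝ] ℝ :=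
  (ContinuousMap.evalCLM ℝ x).comp (toC h)

theorem eval_apply (h : 1 / 2 < s) (x : UnitAddCircle) (f : Sobolev s) : eval h x f = f x := rfl

/-- A Cauchy sequence has two limits: its weighted coefficients converge in `ℓ²`, and by the Sobolev
embedding the functions converge uniformly. Fourier coefficients are continuous for uniform
convergence, so the uniform limit has the `ℓ²` limit as its weighted coefficients. -/
theorem completeSpace (h : 1 / 2 < s) : CompleteSpace (Sobolev s) := by
  refine Metric.complete_of_cauchySeq_tendsto fun u hu => ?_
  have hiso : Isometry (toℓ2 s) := AddMonoidHomClass.isometry_of_norm (toℓ2 s) fun _ => rfl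
  obtain ⟨a, ha⟩ := cauchySeq_tendsto_of_complete
    (hu.map hiso.uniformContinuous : CauchySeq (toℓ2 s ∘ u))
  obtain ⟨f, hf⟩ := cauchySeq_tendsto_of_complete
    (hu.map (toC h).uniformContinuous : CauchySeq (toC h ∘ u))
  have hw : weighted s f = (a : ℤ → ℂ) := by
    funext n
    have h1 : Filter.Tendsto (fun k => (toℓ2 s (u k) : ℤ → ℂ) n) Filter.atTop (𝓝 ((a : ℤ → ℂ) n)) := by
      have h0 := tendsto_pi_nhds.1 (lp.uniformContinuous_coe (p := 2) (E := fun _ : ℤ => ℂ)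
        |>.continuous.tendsto a |>.comp ha) n
      exact h0
    have h2 : Filter.Tendsto (fun k => (toℓ2 s (u k) : ℤ → ℂ) n) Filter.atTop
        (𝓝 (weighted s f n)) :=
      (((fourierCL n).continuous.tendsto f).comp hf).const_smul
        (((1 + (n : ℝ) ^ 2) ^ (s / 2) : ℝ))
    exact tendsto_nhds_unique h2 h1
  have hmem : f ∈ sobolevSubmodule s := by
    change Memℓp (weighted s f) 2
    rw [hw]
    exact a.2
  refine ⟨⟨f, hmem⟩, hiso.isUniformInducing.isInducing.tendsto_nhds_iff.2 ?_⟩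
  have h3 : toℓ2 s ⟨f, hmem⟩ = a := Subtype.ext hw
  rw [h3]
  exact ha

/-- A linear map into a Sobolev space is continuous if all its point evaluations are. -/
theorem continuous_of_eval {X : Type*} [NormedAddCommGroup X] [NormedSpace ℝ X] [CompleteSpace X]
    (h : 1 / 2 < s) (T : X →ₗ[ℝ] Sobolev s) (hT : ∀ x : UnitAddCircle, Continuous fun u => T u x) :
    Continuous T := by
  have := completeSpace h
  -- Closed graph theorem: convergence in `H^s` implies pointwise convergence, so the two candidate
  -- limits agree at every point.
  refine T.continuous_of_seq_closed_graph fun u v w hu hw => ext fun x => ?_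
  exact tendsto_nhds_unique (((eval h x).continuous.tendsto w).comp hw)
    (((hT x).tendsto v).comp hu)

end Sobolev

/-! ### Products -/

open scoped ENNReal

/-- Cauchy–Schwarz for the counting measure, with the product split as `a b = (a b^{1/2}) b^{1/2}`.
-/
theorem ENNReal_sq_tsum_mul_le (a b : ℤ → ℝ≥0∞) :
    (∑' m, a m * b m) ^ 2 ≤ (∑' m, a m ^ 2 * b m) * ∑' m, b m := by
  have h := ENNReal.lintegral_mul_le_Lp_mul_Lq (MeasureTheory.Measure.count : MeasureTheory.Measure ℤ)
    (Real.HolderConjugate.two_two) (f := fun m => a m * b m ^ (1 / 2 : ℝ))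
    (g := fun m => b m ^ (1 / 2 : ℝ)) (Measurable.of_discrete).aemeasurable
    (Measurable.of_discrete).aemeasurable
  simp only [MeasureTheory.lintegral_count, Pi.mul_apply] at h
  have e (m : ℤ) : b m ^ (1 / 2 : ℝ) * b m ^ (1 / 2 : ℝ) = b m := by
    rw [← ENNReal.rpow_add_of_nonneg _ _ (by norm_num) (by norm_num)]
    norm_num
  have e2 (m : ℤ) : (b m ^ (1 / 2 : ℝ)) ^ (2 : ℝ) = b m := by
    rw [← ENNReal.rpow_mul]
    norm_num
  have e3 (m : ℤ) : (a m * b m ^ (1 / 2 : ℝ)) ^ (2 : ℝ) = a m ^ 2 * b m := by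
    rw [ENNReal.mul_rpow_of_nonneg _ _ (by norm_num), e2, ENNReal.rpow_two]
  simp only [mul_assoc, e] at h
  simp only [e2, e3] at h
  refine (pow_le_pow_left' h 2).trans_eq ?_
  rw [← ENNReal.rpow_two, ENNReal.mul_rpow_of_nonneg _ _ (by norm_num), ← ENNReal.rpow_mul,
    ← ENNReal.rpow_mul]
  norm_num

/-- Young's inequality `ℓ² * ℓ¹ ⊆ ℓ²`. -/
theorem ENNReal_tsum_sq_conv_le (a b : ℤ → ℝ≥0∞) :
    ∑' n, (∑' m, a (n - m) * b m) ^ 2 ≤ (∑' n, a n ^ 2) * (∑' m, b m) ^ 2 := by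
  calc ∑' n, (∑' m, a (n - m) * b m) ^ 2
      ≤ ∑' n, (∑' m, a (n - m) ^ 2 * b m) * ∑' m, b m :=
        ENNReal.tsum_le_tsum fun n => ENNReal_sq_tsum_mul_le (fun m => a (n - m)) b
    _ = (∑' m, ∑' n, a (n - m) ^ 2 * b m) * ∑' m, b m := by
        rw [ENNReal.tsum_mul_right, ENNReal.tsum_comm]
    _ = (∑' n, a n ^ 2) * (∑' m, b m) ^ 2 := by
        have (m : ℤ) : ∑' n, a (n - m) ^ 2 * b m = (∑' n, a n ^ 2) * b m := by
          rw [ENNReal.tsum_mul_right, ← (Equiv.subRight m).tsum_eq (fun n => a n ^ 2)]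
          rfl
        simp only [this]
        rw [ENNReal.tsum_mul_left, sq, mul_assoc]

/-- Multiply the uniformly convergent Fourier series of `f` by `g` and apply the continuous
functional "`n`-th coefficient" termwise; multiplying `g` by the `m`-th character shifts its
coefficients by `m`. Only one factor needs an absolutely convergent series. -/
theorem hasSum_fourierC_mul (f g : C(UnitAddCircle, ℝ)) (hf : Summable (fourierC f)) (n : ℤ) :
    HasSum (fun m => fourierC f m * fourierC g (n - m)) (fourierC (f * g) n) := by
  let toComplex : C(UnitAddCircle, ℝ) → C(UnitAddCircle, ℂ) := fun f =>
    ⟨fun x => (f x : ℂ), Complex.continuous_ofReal.comp f.continuous⟩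
  have hi (F : C(UnitAddCircle, ℂ)) : MeasureTheory.Integrable F
      (AddCircle.haarAddCircle (T := (1 : ℝ))) :=
    F.continuous.integrable_of_hasCompactSupport (HasCompactSupport.of_compactSpace _)
  let Lₗ : C(UnitAddCircle, ℂ) →ₗ[ℂ] ℂ :=
    { toFun := fun F => fourierCoeff F n
      map_add' := fun F G => congrFun (fourierCoeff.add (hi F) (hi G)) n
      map_smul' := fun c F => fourierCoeff.const_smul F c n }
  let L : C(UnitAddCircle, ℂ) →L[ℂ] ℂ := Lₗ.mkContinuous 1 fun F => by
    rw [one_mul]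
    refine (MeasureTheory.norm_integral_le_of_norm_le_const (C := ‖F‖) ?_).trans_eq (by simp)
    refine Filter.Eventually.of_forall fun x => ?_
    rw [norm_smul, Sobolev.norm_fourier_apply, one_mul]
    exact F.norm_coe_le_norm x
  have h1 := hasSum_fourier_series_of_summable (f := toComplex f) hf
  have h2 := L.hasSum (h1.mul_right (toComplex g))
  have e1 : L (toComplex f * toComplex g) = fourierC (f * g) n := by
    change fourierCoeff _ n = fourierCoeff _ n
    congr 1
    funext x
    simp [toComplex]
  rw [e1] at h2
  refine h2.congr_fun fun m => ?_
  rw [smul_mul_assoc, map_smul, smul_eq_mul]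
  congr 1
  change fourierCoeff _ _ = fourierCoeff _ _
  rw [fourierCoeff, fourierCoeff]
  congr 1
  funext x
  simp only [ContinuousMap.mul_apply, smul_eq_mul, ← mul_assoc]
  rw [neg_sub, sub_eq_add_neg, add_comm, fourier_add]
  rfl

namespace Sobolev

variable {s : ℝ}

/-- The Wiener norm `∑ |f̂(n)|`, possibly infinite. -/
def wienerE (f : C(UnitAddCircle, ℝ)) : ℝ≥0∞ := ∑' n, ‖fourierC f n‖ₑ

/-- The weight `(1 + n²)^{s/2}`. -/
def weightE (s : ℝ) (n : ℤ) : ℝ≥0∞ := ENNReal.ofReal ((1 + (n : ℝ) ^ 2) ^ (s / 2))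

/-- The square of the Sobolev norm, possibly infinite. -/
def sqNormE (s : ℝ) (f : C(UnitAddCircle, ℝ)) : ℝ≥0∞ :=
  ∑' n, (weightE s n * ‖fourierC f n‖ₑ) ^ 2

theorem weightE_mul_sq (f : C(UnitAddCircle, ℝ)) (n : ℤ) :
    (weightE s n * ‖fourierC f n‖ₑ) ^ 2
      = ENNReal.ofReal ((1 + (n : ℝ) ^ 2) ^ s * ‖fourierC f n‖ ^ 2) := by
  rw [weightE, ← ofReal_norm, ← ENNReal.ofReal_mul (weight_pos n _).le,
    ← ENNReal.ofReal_pow (by positivity), mul_pow, ← Real.rpow_natCast (_ ^ (s / 2)),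
    ← Real.rpow_mul (by positivity)]
  norm_num

/-- The element of `H^s(S¹)` given by a continuous function. -/
def ofMem (f : C(UnitAddCircle, ℝ)) (hf : f ∈ sobolevSubmodule s) : Sobolev s := ⟨f, hf⟩

theorem toCₗ_ofMem (f : C(UnitAddCircle, ℝ)) (hf : f ∈ sobolevSubmodule s) :
    toCₗ s (ofMem f hf) = f := rfl

theorem mem_of_sqNormE_ne_top {f : C(UnitAddCircle, ℝ)} (h : sqNormE s f ≠ ⊤) :
    f ∈ sobolevSubmodule s := by
  rw [mem_sobolevSubmodule_iff]
  simp only [sqNormE, weightE_mul_sq] at h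
  refine (ENNReal.summable_toReal h).congr fun n => ?_
  rw [ENNReal.toReal_ofReal (by positivity)]

theorem sqNormE_eq (f : Sobolev s) : sqNormE s (toCₗ s f) = ENNReal.ofReal (‖f‖ ^ 2) := by
  simp only [sqNormE, weightE_mul_sq]
  rw [← (hasSum_norm_sq f).tsum_eq, ENNReal.ofReal_tsum_of_nonneg (fun n => by positivity)
    (hasSum_norm_sq f).summable]

/-- If `b` is the larger in absolute value of the two summands of `n = (n - m) + m`, then `1 + n² ≤
4 (1 + b²)`. The constant `4^{s/2}` is the square of the weight `2^{s/2}` at `1`. -/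
theorem weightE_le (hs : 0 ≤ s) (n m : ℤ) :
    weightE s n ≤ weightE s 1 ^ 2 * (weightE s (n - m) + weightE s m) := by
  have e1 : (1 + ((1 : ℤ) : ℝ) ^ 2) ^ (s / 2) * (1 + ((1 : ℤ) : ℝ) ^ 2) ^ (s / 2)
      = (4 : ℝ) ^ (s / 2) := by
    rw [← Real.mul_rpow (by positivity) (by positivity)]
    norm_num
  rw [sq, weightE, weightE, weightE, weightE, ← ENNReal.ofReal_mul (by positivity), e1,
    ← ENNReal.ofReal_add (weight_pos _ _).le (weight_pos _ _).le,
    ← ENNReal.ofReal_mul (by positivity)]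
  refine ENNReal.ofReal_le_ofReal ?_
  have key : ∀ a b : ℝ, a ^ 2 ≤ b ^ 2 → (1 + (a + b) ^ 2) ^ (s / 2)
      ≤ 4 ^ (s / 2) * (1 + b ^ 2) ^ (s / 2) := by
    intro a b hab
    rw [← Real.mul_rpow (by positivity) (by positivity)]
    refine Real.rpow_le_rpow (by positivity) ?_ (by positivity)
    nlinarith [sq_nonneg (a - b)]
  push_cast
  rcases le_total ((n - m : ℝ) ^ 2) ((m : ℝ) ^ 2) with h | h
  · have := key _ _ h
    rw [sub_add_cancel] at this
    refine this.trans ?_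
    gcongr
    exact le_add_of_nonneg_left (by positivity)
  · have := key _ _ h
    rw [add_sub_cancel] at this
    refine this.trans ?_
    gcongr
    exact le_add_of_nonneg_right (by positivity)

theorem ENNReal_add_sq_le (x y : ℝ≥0∞) : (x + y) ^ 2 ≤ 4 * (x ^ 2 + y ^ 2) := by
  have key : ∀ x y : ℝ≥0∞, x ≤ y → (x + y) ^ 2 ≤ 4 * (x ^ 2 + y ^ 2) := by
    intro x y h
    calc (x + y) ^ 2 ≤ (y + y) ^ 2 := by gcongr
      _ = 4 * y ^ 2 := by ring
      _ ≤ _ := by gcongr; exact le_add_self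
  rcases le_total x y with h | h
  · exact key x y h
  · rw [add_comm x, add_comm (x ^ 2)]
    exact key y x h

/-- `weightE_le` moves the weight in the convolution onto one factor at a time, and Young's
inequality bounds each of the two convolutions. Each term of the bound thus contains only one
Sobolev norm; the other factor is measured in the weaker Wiener norm. -/
theorem sqNormE_mul_le (hs : 0 ≤ s) (f g : C(UnitAddCircle, ℝ)) (hf : wienerE f ≠ ⊤) :
    sqNormE s (f * g) ≤ 4 * weightE s 1 ^ 4 *
      (sqNormE s g * wienerE f ^ 2 + sqNormE s f * wienerE g ^ 2) := by
  have hsum : Summable (fourierC f) := by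
    refine Summable.of_norm ?_
    simpa using ENNReal.summable_toReal hf
  have h1 (n : ℤ) : ‖fourierC (f * g) n‖ₑ ≤ ∑' m, ‖fourierC g (n - m)‖ₑ * ‖fourierC f m‖ₑ := by
    rw [← (hasSum_fourierC_mul f g hsum n).tsum_eq]
    refine enorm_tsum_le_tsum_enorm.trans_eq (tsum_congr fun m => ?_)
    rw [enorm_mul, mul_comm]
  have h2 (n : ℤ) : weightE s n * ‖fourierC (f * g) n‖ₑ ≤ weightE s 1 ^ 2 *
      ((∑' m, (weightE s (n - m) * ‖fourierC g (n - m)‖ₑ) * ‖fourierC f m‖ₑ) +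
        ∑' m, (weightE s (n - m) * ‖fourierC f (n - m)‖ₑ) * ‖fourierC g m‖ₑ) := by
    -- Reindexing by `m ↦ n - m` puts the weighted factor at `n - m`, as `ENNReal_tsum_sq_conv_le`
    -- expects.
    have e : ∑' m, (weightE s (n - m) * ‖fourierC f (n - m)‖ₑ) * ‖fourierC g m‖ₑ
        = ∑' m, (weightE s m * ‖fourierC f m‖ₑ) * ‖fourierC g (n - m)‖ₑ := by
      rw [← (Equiv.subLeft n).tsum_eq]
      simp
    rw [e, ← ENNReal.tsum_add, ← ENNReal.tsum_mul_left]
    refine (mul_le_mul_right (h1 n) _).trans ?_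
    rw [← ENNReal.tsum_mul_left]
    refine ENNReal.tsum_le_tsum fun m => ?_
    refine (mul_le_mul_left (weightE_le hs n m) _).trans_eq ?_
    ring
  calc sqNormE s (f * g) ≤ ∑' n, (weightE s 1 ^ 2) ^ 2 *
        (4 * ((∑' m, (weightE s (n - m) * ‖fourierC g (n - m)‖ₑ) * ‖fourierC f m‖ₑ) ^ 2 +
          (∑' m, (weightE s (n - m) * ‖fourierC f (n - m)‖ₑ) * ‖fourierC g m‖ₑ) ^ 2)) := by
        refine ENNReal.tsum_le_tsum fun n => ?_
        refine (pow_le_pow_left' (h2 n) 2).trans ?_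
        rw [mul_pow]
        gcongr
        exact ENNReal_add_sq_le _ _
    _ = 4 * weightE s 1 ^ 4 *
        ((∑' n, (∑' m, (weightE s (n - m) * ‖fourierC g (n - m)‖ₑ) * ‖fourierC f m‖ₑ) ^ 2) +
          ∑' n, (∑' m, (weightE s (n - m) * ‖fourierC f (n - m)‖ₑ) * ‖fourierC g m‖ₑ) ^ 2) := by
        rw [ENNReal.tsum_mul_left, ENNReal.tsum_mul_left, ENNReal.tsum_add]
        ring
    _ ≤ _ := by
        gcongr
        · exact ENNReal_tsum_sq_conv_le (fun n => weightE s n * ‖fourierC g n‖ₑ) _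
        · exact ENNReal_tsum_sq_conv_le (fun n => weightE s n * ‖fourierC f n‖ₑ) _

/-- The Wiener norm `∑ |f̂(n)|`. -/
def wiener (f : Sobolev s) : ℝ := ∑' n, ‖fourierC (toCₗ s f) n‖

theorem wiener_nonneg (f : Sobolev s) : 0 ≤ wiener f := tsum_nonneg fun _ => norm_nonneg _

theorem exists_wiener_le (h : 1 / 2 < s) : ∃ C : ℝ, 0 ≤ C ∧ ∀ f : Sobolev s,
    Summable (fun n => ‖fourierC (toCₗ s f) n‖) ∧ wiener f ≤ C * ‖f‖ := by
  obtain ⟨C, hC⟩ := exists_tsum_le (s := s) (t := 0) (by linarith)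
  simp only [zero_div, Real.rpow_zero, one_mul] at hC
  refine ⟨max C 0, le_max_right _ _, fun f => ⟨(hC f).1, (hC f).2.trans ?_⟩⟩
  gcongr
  exact le_max_left _ _

theorem wienerE_eq (h : 1 / 2 < s) (f : Sobolev s) :
    wienerE (toCₗ s f) = ENNReal.ofReal (wiener f) := by
  obtain ⟨C, -, hC⟩ := exists_wiener_le h
  rw [wiener, ENNReal.ofReal_tsum_of_nonneg (fun _ => norm_nonneg _) (hC f).1]
  simp only [ofReal_norm]
  rfl

theorem exists_norm_mul_le (h : 1 / 2 < s) : ∃ C : ℝ, 0 ≤ C ∧ ∀ f g : Sobolev s,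
    ∃ p : Sobolev s, (∀ x, p x = f x * g x) ∧ ‖p‖ ≤ C * (‖g‖ * wiener f + ‖f‖ * wiener g) := by
  have hw : 0 ≤ (1 + ((1 : ℤ) : ℝ) ^ 2) ^ (s / 2) := (weight_pos 1 _).le
  set W : ℝ := (1 + ((1 : ℤ) : ℝ) ^ 2) ^ (s / 2) with hW
  -- The constant comes from `4 W⁴ (A² + B²) ≤ (2 W² (A + B))²` for `A, B ≥ 0`.
  refine ⟨2 * W ^ 2, by positivity, fun f g => ?_⟩
  have hf := wiener_nonneg f
  have hg := wiener_nonneg g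
  have key := sqNormE_mul_le (s := s) (by linarith) (toCₗ s f) (toCₗ s g)
    (by rw [wienerE_eq h]; exact ENNReal.ofReal_ne_top)
  have e4 : (4 : ℝ≥0∞) = ENNReal.ofReal 4 := by norm_num
  rw [wienerE_eq h, wienerE_eq h, sqNormE_eq, sqNormE_eq, weightE, ← hW, e4,
    ← ENNReal.ofReal_pow hw, ← ENNReal.ofReal_pow hf, ← ENNReal.ofReal_pow hg,
    ← ENNReal.ofReal_mul (by positivity), ← ENNReal.ofReal_mul (by positivity),
    ← ENNReal.ofReal_mul (by positivity), ← ENNReal.ofReal_add (by positivity) (by positivity),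
    ← ENNReal.ofReal_mul (by positivity)] at key
  have hmem : toCₗ s f * toCₗ s g ∈ sobolevSubmodule s :=
    mem_of_sqNormE_ne_top (key.trans_lt ENNReal.ofReal_lt_top).ne
  refine ⟨ofMem _ hmem, fun x => rfl, ?_⟩
  have e : sqNormE s (toCₗ s f * toCₗ s g)
      = ENNReal.ofReal (‖ofMem _ hmem‖ ^ 2) := sqNormE_eq (ofMem _ hmem)
  rw [e, ENNReal.ofReal_le_ofReal_iff (by positivity)] at key
  refine le_of_sq_le_sq (key.trans ?_) (by positivity)
  have : 0 ≤ W ^ 4 * (‖g‖ * wiener f * (‖f‖ * wiener g)) := by positivity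
  nlinarith

/-- Multiplication in `H^s(S¹)`, `s > 1/2`. -/
def mulFun (h : 1 / 2 < s) (f g : Sobolev s) : Sobolev s :=
  ((exists_norm_mul_le h).choose_spec.2 f g).choose

theorem mulFun_apply (h : 1 / 2 < s) (f g : Sobolev s) (x : UnitAddCircle) :
    mulFun h f g x = f x * g x :=
  ((exists_norm_mul_le h).choose_spec.2 f g).choose_spec.1 x

theorem add_apply (f g : Sobolev s) (x : UnitAddCircle) : (f + g) x = f x + g x := rfl

theorem sub_apply (f g : Sobolev s) (x : UnitAddCircle) : (f - g) x = f x - g x := rfl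

theorem smul_apply (c : ℝ) (f : Sobolev s) (x : UnitAddCircle) : (c • f) x = c * f x := rfl

theorem one_apply (x : UnitAddCircle) : one s x = 1 := rfl

theorem exists_norm_mulFun_le (h : 1 / 2 < s) : ∃ C : ℝ, 0 ≤ C ∧ ∀ f g : Sobolev s,
    ‖mulFun h f g‖ ≤ C * (‖g‖ * wiener f + ‖f‖ * wiener g) :=
  ⟨_, (exists_norm_mul_le h).choose_spec.1, fun f g =>
    ((exists_norm_mul_le h).choose_spec.2 f g).choose_spec.2⟩

/-- Multiplication in `H^s(S¹)` as a continuous bilinear map. -/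
def mulL (h : 1 / 2 < s) : Sobolev s →L[ℝ] Sobolev s →L[ℝ] Sobolev s :=
  LinearMap.mkContinuousOfExistsBound₂
    (LinearMap.mk₂ ℝ (mulFun h)
      (fun f g k => ext fun x => by simp only [mulFun_apply, add_apply, add_mul])
      (fun c f g => ext fun x => by simp only [mulFun_apply, smul_apply, mul_assoc])
      (fun f g k => ext fun x => by simp only [mulFun_apply, add_apply, mul_add])
      (fun c f g => ext fun x => by simp only [mulFun_apply, smul_apply]; ring)) (by
    obtain ⟨C, hC, hm⟩ := exists_norm_mulFun_le h
    obtain ⟨A, hA, hw⟩ := exists_wiener_le h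
    refine ⟨C * (A + A), fun f g => (hm f g).trans ?_⟩
    have h1 := (hw f).2
    have h2 := (hw g).2
    rw [mul_assoc, mul_assoc]
    refine mul_le_mul_of_nonneg_left ?_ hC
    nlinarith [mul_le_mul_of_nonneg_left h1 (norm_nonneg g),
      mul_le_mul_of_nonneg_left h2 (norm_nonneg f)])

theorem mulL_apply (h : 1 / 2 < s) (f g : Sobolev s) (x : UnitAddCircle) :
    mulL h f g x = f x * g x := mulFun_apply h f g x

theorem exists_norm_mulL_le (h : 1 / 2 < s) : ∃ C : ℝ, 0 ≤ C ∧ ∀ f g : Sobolev s,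
    ‖mulL h f g‖ ≤ C * (‖g‖ * wiener f + ‖f‖ * wiener g) := exists_norm_mulFun_le h

end Sobolev

/-! ### Derivatives and Fourier coefficients -/

theorem circle_forall {p : UnitAddCircle → Prop} (h : ∀ x : ℝ, p (x : UnitAddCircle)) (x : UnitAddCircle) :
    p x := by
  induction x using QuotientAddGroup.induction_on with
  | H x => exact h x

theorem continuous_lift (f : C(UnitAddCircle, ℝ)) : Continuous fun x : ℝ => f (x : UnitAddCircle) :=
  f.continuous.comp (AddCircle.continuous_mk' 1)

theorem circle_one_eq_zero : ((1 : ℝ) : UnitAddCircle) = ((0 : ℝ) : UnitAddCircle) := by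
  rw [QuotientAddGroup.mk_zero]
  exact AddCircle.coe_period 1

theorem fourierC_eq_intervalIntegral (f : C(UnitAddCircle, ℝ)) (n : ℤ) :
    fourierC f n = ∫ x in (0 : ℝ)..1, (fourier (-n) (x : UnitAddCircle) : ℂ) * (f x : ℂ) := by
  rw [fourierC, fourierCoeff_eq_intervalIntegral _ n 0]
  simp

/-- Integration by parts over one period; the boundary terms cancel by periodicity. -/
theorem fourierC_deriv {f g : C(UnitAddCircle, ℝ)}
    (hfg : ∀ x : ℝ, HasDerivAt (fun y : ℝ => f y) (g x) x) (n : ℤ) :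
    fourierC g n = 2 * Real.pi * Complex.I * n * fourierC f n := by
  have hu (x : ℝ) : HasDerivAt (fun y : ℝ => (fourier (-n) (y : UnitAddCircle) : ℂ))
      (-2 * Real.pi * Complex.I * n * fourier (-n) (x : UnitAddCircle)) x := by
    simpa using hasDerivAt_fourier_neg (1 : ℝ) n x
  have hv (x : ℝ) : HasDerivAt (fun y : ℝ => (f y : ℂ)) (g x : ℂ) x := (hfg x).ofReal_comp
  have hc (m : ℤ) : Continuous fun x : ℝ => (fourier m (x : UnitAddCircle) : ℂ) :=
    (fourier m).continuous.comp (AddCircle.continuous_mk' 1)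
  have hcg : Continuous fun x : ℝ => (g (x : UnitAddCircle) : ℂ) :=
    Complex.continuous_ofReal.comp (continuous_lift g)
  have h := intervalIntegral.integral_mul_deriv_eq_deriv_mul (a := 0) (b := 1)
    (fun x _ => hu x) (fun x _ => hv x)
    (((hc (-n)).const_mul (-2 * Real.pi * Complex.I * n)).intervalIntegrable 0 1)
    (hcg.intervalIntegrable 0 1)
  rw [fourierC_eq_intervalIntegral, h, circle_one_eq_zero, sub_self, zero_sub,
    fourierC_eq_intervalIntegral, ← intervalIntegral.integral_const_mul,
    ← intervalIntegral.integral_neg]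
  congr 1
  funext x
  ring

/-- Parseval, together with the bound of the `L²` norm by the supremum norm on a probability space.
-/
theorem summable_sq_fourierC (f : C(UnitAddCircle, ℝ)) :
    Summable (fun n => ‖fourierC f n‖ ^ 2) ∧ ∑' n, ‖fourierC f n‖ ^ 2 ≤ ‖f‖ ^ 2 := by
  let F : C(UnitAddCircle, ℂ) := ⟨fun x => (f x : ℂ),
    Complex.continuous_ofReal.comp f.continuous⟩
  have h := hasSum_sq_fourierCoeff (ContinuousMap.toLp (E := ℂ) 2 AddCircle.haarAddCircle ℂ F)
  have e (n : ℤ) : fourierCoeff (ContinuousMap.toLp (E := ℂ) 2 AddCircle.haarAddCircle ℂ F) n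
      = fourierC f n := fourierCoeff_toLp F n
  simp only [e] at h
  refine ⟨h.summable, ?_⟩
  rw [h.tsum_eq]
  refine (le_abs_self _).trans ?_
  rw [← Real.norm_eq_abs]
  refine (MeasureTheory.norm_integral_le_of_norm_le_const (C := ‖f‖ ^ 2) ?_).trans_eq (by simp)
  filter_upwards [ContinuousMap.coeFn_toLp (p := 2) (𝕜 := ℂ) AddCircle.haarAddCircle F] with x hx
  rw [hx, norm_pow, norm_norm]
  refine pow_le_pow_left₀ (norm_nonneg _) ?_ 2
  change ‖((f x : ℝ) : ℂ)‖ ≤ _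
  rw [Complex.norm_real]
  exact f.norm_coe_le_norm x

namespace Sobolev

variable {s : ℝ}

theorem norm_fourierC_deriv_sq {f g : C(UnitAddCircle, ℝ)}
    (hfg : ∀ x : ℝ, HasDerivAt (fun y : ℝ => f y) (g x) x) (n : ℤ) :
    ‖fourierC g n‖ ^ 2 = (2 * Real.pi) ^ 2 * (n : ℝ) ^ 2 * ‖fourierC f n‖ ^ 2 := by
  rw [fourierC_deriv hfg]
  simp only [norm_mul, Complex.norm_I, Complex.norm_real, Complex.norm_intCast,
      Complex.norm_ofNat, Real.norm_of_nonneg Real.pi_pos.le, mul_one, mul_pow, sq_abs]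

theorem sq_mul_norm_fourierC_le {f g : C(UnitAddCircle, ℝ)}
    (hfg : ∀ x : ℝ, HasDerivAt (fun y : ℝ => f y) (g x) x) (n : ℤ) :
    (n : ℝ) ^ 2 * ‖fourierC f n‖ ^ 2 ≤ ‖fourierC g n‖ ^ 2 := by
  rw [norm_fourierC_deriv_sq hfg, mul_assoc]
  refine le_mul_of_one_le_left (by positivity) ?_
  nlinarith [Real.pi_gt_three]

theorem deriv_mem {f g : C(UnitAddCircle, ℝ)}
    (hfg : ∀ x : ℝ, HasDerivAt (fun y : ℝ => f y) (g x) x) (hf : f ∈ sobolevSubmodule s) :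
    g ∈ sobolevSubmodule (s - 1) := by
  rw [mem_sobolevSubmodule_iff] at hf ⊢
  refine Summable.of_nonneg_of_le (fun n => by positivity) (fun n => ?_)
    (hf.mul_left ((2 * Real.pi) ^ 2))
  rw [norm_fourierC_deriv_sq hfg]
  calc (1 + (n : ℝ) ^ 2) ^ (s - 1) * ((2 * Real.pi) ^ 2 * (n : ℝ) ^ 2 * ‖fourierC f n‖ ^ 2)
      ≤ (1 + (n : ℝ) ^ 2) ^ (s - 1) *
        ((2 * Real.pi) ^ 2 * (1 + (n : ℝ) ^ 2) * ‖fourierC f n‖ ^ 2) := by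
        gcongr
        linarith
    _ = _ := by
        rw [Real.rpow_sub_one (by positivity)]
        field_simp

theorem mem_of_deriv_mem {f g : C(UnitAddCircle, ℝ)}
    (hfg : ∀ x : ℝ, HasDerivAt (fun y : ℝ => f y) (g x) x) (hg : g ∈ sobolevSubmodule (s - 1)) :
    f ∈ sobolevSubmodule s := by
  rw [mem_sobolevSubmodule_iff] at hg ⊢
  -- The derivative does not see the mean, so the mode `n = 0` is discarded; for the others `1 + n²
  -- ≤ 2 n²` accounts for the factor `2`.
  refine Summable.of_norm_bounded_eventually (hg.mul_left 2) ?_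
  filter_upwards [(Set.finite_singleton (0 : ℤ)).compl_mem_cofinite] with n hn
  have hn' : (1 : ℝ) ≤ (n : ℝ) ^ 2 := by
    have : 0 < n ^ 2 := sq_pos_of_ne_zero hn
    exact_mod_cast this
  rw [Real.norm_of_nonneg (by positivity)]
  calc (1 + (n : ℝ) ^ 2) ^ s * ‖fourierC f n‖ ^ 2
      = (1 + (n : ℝ) ^ 2) ^ (s - 1) * ((1 + (n : ℝ) ^ 2) * ‖fourierC f n‖ ^ 2) := by
        rw [Real.rpow_sub_one (by positivity)]
        field_simp
    _ ≤ (1 + (n : ℝ) ^ 2) ^ (s - 1) * (2 * ‖fourierC g n‖ ^ 2) := by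
        refine mul_le_mul_of_nonneg_left ?_ (by positivity)
        have := sq_mul_norm_fourierC_le hfg n
        nlinarith [sq_nonneg ‖fourierC f n‖]
    _ = _ := by ring

/-- By Parseval the `H¹` norm is controlled by the supremum norms of `f` and `f'`, and the Wiener
norm by the `H¹` norm. The `C¹` bound is what allows the powers of a function to be estimated
pointwise. -/
theorem exists_wiener_le_deriv : ∃ C : ℝ, 0 ≤ C ∧ ∀ f g : C(UnitAddCircle, ℝ),
    (∀ x : ℝ, HasDerivAt (fun y : ℝ => f y) (g x) x) →
    ∑' n, ‖fourierC f n‖ ≤ C * (‖f‖ + ‖g‖) := by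
  obtain ⟨C, hC, h⟩ := exists_wiener_le (s := 1) (by norm_num)
  refine ⟨C, hC, fun f g hfg => ?_⟩
  obtain ⟨hf1, hf2⟩ := summable_sq_fourierC f
  obtain ⟨hg1, hg2⟩ := summable_sq_fourierC g
  have hle (n : ℤ) : (1 + (n : ℝ) ^ 2) ^ (1 : ℝ) * ‖fourierC f n‖ ^ 2
      ≤ ‖fourierC f n‖ ^ 2 + ‖fourierC g n‖ ^ 2 := by
    have := sq_mul_norm_fourierC_le hfg n
    rw [Real.rpow_one]
    linarith
  have hmem : f ∈ sobolevSubmodule 1 := by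
    rw [mem_sobolevSubmodule_iff]
    exact Summable.of_nonneg_of_le (fun n => by positivity) hle (hf1.add hg1)
  have hs := hasSum_norm_sq (ofMem f hmem)
  have hn : ‖ofMem f hmem‖ ^ 2 ≤ (‖f‖ + ‖g‖) ^ 2 := by
    have h1 := hasSum_le hle hs (hf1.add hg1).hasSum
    rw [hf1.tsum_add hg1] at h1
    nlinarith [norm_nonneg f, norm_nonneg g]
  refine ((h (ofMem f hmem)).2).trans ?_
  gcongr
  exact le_of_sq_le_sq hn (by positivity)

/-! ### Inverses of positive functions -/

theorem mulL_pow_apply (h : 1 / 2 < s) (f u : Sobolev s) (k : ℕ) (x : UnitAddCircle) :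
    ((mulL h f) ^ k) u x = f x ^ k * u x := by
  induction k with
  | zero => simp
  | succ k ih =>
    rw [pow_succ', mul_apply_eq_comp, mulL_apply, ih]
    ring

theorem mulL_mulL (h : 1 / 2 < s) (f g : Sobolev s) :
    mulL h (mulL h f g) = mulL h f * mulL h g := by
  ext u
  refine ext fun x => ?_
  rw [mul_apply_eq_comp, mulL_apply, mulL_apply, mulL_apply, mulL_apply, mul_assoc]

theorem mulL_one (h : 1 / 2 < s) : mulL h (one s) = 1 := by
  ext u
  refine ext fun x => ?_
  rw [mulL_apply, one_apply, one_mul, one_apply_eq_self]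

/-- The function `g^k` is bounded by `ρ^k` and its derivative `k g^{k-1} g'` by a multiple of `k
ρ^{k-1}`; both tend to `0`. -/
theorem tendsto_wiener_pow (h : 3 / 2 < s) (g : Sobolev s) {ρ : ℝ} (hρ : ρ < 1)
    (hg : ∀ x, |g x| ≤ ρ) :
    Filter.Tendsto (fun k : ℕ => wiener (((mulL (by linarith : 1 / 2 < s) g) ^ k) (one s)))
      Filter.atTop (𝓝 0) := by
  have h' : 1 / 2 < s := by linarith
  obtain ⟨C, hC, hw⟩ := exists_wiener_le_deriv
  obtain ⟨D, hD⟩ := exists_deriv h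
  have hρ0 : 0 ≤ ρ := (abs_nonneg _).trans (hg 0)
  obtain ⟨p, hp⟩ : ∃ p : ℕ → Sobolev s, p = fun k => ((mulL h' g) ^ k) (one s) := ⟨_, rfl⟩
  have hpx (k : ℕ) (x : UnitAddCircle) : p k x = g x ^ k := by
    rw [hp]
    simp only [mulL_pow_apply, one_apply, mul_one]
  have hnorm (k : ℕ) : ‖toCₗ s (p k)‖ ≤ ρ ^ k := by
    rw [ContinuousMap.norm_le _ (by positivity)]
    intro x
    rw [hpx, norm_pow]
    exact pow_le_pow_left₀ (norm_nonneg _) (hg x) k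
  -- The truncated exponent at `k = 0` is harmless, since the factor `k` vanishes there.
  have hderiv (k : ℕ) : ‖D (p k)‖ ≤ k * ρ ^ (k - 1) * ‖D g‖ := by
    rw [ContinuousMap.norm_le _ (by positivity)]
    refine circle_forall fun x => ?_
    have h1 := hD (p k) x
    simp only [hpx] at h1
    rw [h1.unique ((hD g x).pow k), norm_mul, norm_mul, norm_pow, Real.norm_natCast]
    gcongr
    · exact hg x
    · exact (D g).norm_coe_le_norm x
  have hbound (k : ℕ) : wiener (p k) ≤ C * (ρ ^ k + k * ρ ^ (k - 1) * ‖D g‖) := by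
    refine (hw _ _ (hD (p k))).trans ?_
    gcongr
    · exact hnorm k
    · exact hderiv k
  change Filter.Tendsto (fun k => wiener (((mulL h' g) ^ k) (one s))) _ _
  have hpk (k : ℕ) : ((mulL h' g) ^ k) (one s) = p k := by rw [hp]
  simp only [hpk]
  refine squeeze_zero (fun k => wiener_nonneg _) hbound ?_
  have t1 := tendsto_pow_atTop_nhds_zero_of_lt_one hρ0 hρ
  have t2 : Filter.Tendsto (fun k : ℕ => (k : ℝ) * ρ ^ (k - 1)) Filter.atTop (𝓝 0) := by
    rw [← Filter.tendsto_add_atTop_iff_nat 1]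
    have := (tendsto_self_mul_const_pow_of_lt_one hρ0 hρ).add t1
    simp only [add_zero] at this
    refine this.congr fun k => ?_
    push_cast
    ring
  simpa using (t1.add (t2.mul_const ‖D g‖)).const_mul C

/-- The tame estimate for a square reads `‖u²‖ ≤ 2 C w(u) ‖u‖`. Along `u = g^(2^k)` the factor `2 C
w(u)` tends to `0`, so these powers tend to `0` in `H^s`, and some power of the multiplication
operator has norm below `1`. -/
theorem isUnit_one_sub_mulL (h : 3 / 2 < s) (g : Sobolev s) {ρ : ℝ} (hρ : ρ < 1)
    (hg : ∀ x, |g x| ≤ ρ) : IsUnit (1 - mulL (by linarith : 1 / 2 < s) g) := by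
  have h' : 1 / 2 < s := by linarith
  have := completeSpace h'
  obtain ⟨C, hC, hm⟩ := exists_norm_mulL_le h'
  obtain ⟨p, hp⟩ : ∃ p : ℕ → Sobolev s, p = fun k => ((mulL h' g) ^ k) (one s) := ⟨_, rfl⟩
  have hpx (k : ℕ) (x : UnitAddCircle) : p k x = g x ^ k := by
    rw [hp]
    simp only [mulL_pow_apply, one_apply, mul_one]
  have hdouble (k : ℕ) : p (2 ^ (k + 1)) = mulL h' (p (2 ^ k)) (p (2 ^ k)) := ext fun x => by
    rw [mulL_apply, hpx, hpx, pow_succ, pow_mul, sq]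
  have hM (k : ℕ) : mulL h' (p k) = mulL h' g ^ k := by
    ext u
    refine ext fun x => ?_
    rw [mulL_apply, hpx, mulL_pow_apply]
  have hstep (k : ℕ) : ‖p (2 ^ (k + 1))‖ ≤ 2 * C * wiener (p (2 ^ k)) * ‖p (2 ^ k)‖ := by
    rw [hdouble]
    exact (hm _ _).trans_eq (by ring)
  have hw : Filter.Tendsto (fun k : ℕ => 2 * C * wiener (p (2 ^ k))) Filter.atTop (𝓝 0) := by
    have hpk (k : ℕ) : ((mulL h' g) ^ k) (one s) = p k := by rw [hp]
    have := ((tendsto_wiener_pow h g hρ hg).comp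
      (tendsto_pow_atTop_atTop_of_one_lt (one_lt_two : (1 : ℕ) < 2))).const_mul (2 * C)
    simpa only [Function.comp_def, hpk, mul_zero] using this
  -- From `N` on, each squaring at least halves the norm bound.
  obtain ⟨N, hN⟩ := Filter.eventually_atTop.1 (hw.eventually_le_const (half_pos one_pos))
  have hgeo (k : ℕ) : ‖p (2 ^ (N + k))‖ ≤ (1 / 2) ^ k * ‖p (2 ^ N)‖ := by
    induction k with
    | zero => simp
    | succ k ih =>
      refine (hstep (N + k)).trans ?_
      have h1 := mul_le_mul (hN (N + k) (by omega)) ih (norm_nonneg _) (by norm_num)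
      refine h1.trans_eq ?_
      ring
  have hlim : Filter.Tendsto (fun k : ℕ => ‖mulL h'‖ * ((1 / 2) ^ k * ‖p (2 ^ N)‖)) Filter.atTop
      (𝓝 0) := by
    have := ((tendsto_pow_atTop_nhds_zero_of_lt_one (r := (1 / 2 : ℝ)) (by norm_num)
      (by norm_num)).mul_const ‖p (2 ^ N)‖).const_mul ‖mulL h'‖
    simpa using this
  obtain ⟨k, hk⟩ := (hlim.eventually_lt_const one_pos).exists
  have hlt : ‖mulL h' g ^ (2 ^ (N + k))‖ < 1 := by
    rw [← hM]
    refine ((mulL h').le_opNorm _).trans_lt (lt_of_le_of_lt ?_ hk)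
    gcongr
    exact hgeo k
  have hu := isUnit_one_sub_of_norm_lt_one hlt
  -- With `T` the multiplication operator, `1 - T^m = (1 - T) ∑ T^i`; commuting factors of a unit
  -- are units.
  rw [← mul_neg_geom_sum] at hu
  refine ((Commute.isUnit_mul_iff ?_).1 hu).1
  exact Commute.sum_right _ _ _ fun i _ => ((Commute.one_left _).sub_left (Commute.refl _)).pow_right i

/-- Multiplication by a positive function of class `H^s`, `s > 3/2`, is invertible. -/
theorem isUnit_mulL (h : 3 / 2 < s) (f : Sobolev s) (hf : ∀ x, 0 < f x) :
    IsUnit (mulL (by linarith : 1 / 2 < s) f) := by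
  have h' : 1 / 2 < s := by linarith
  obtain ⟨x₀, -, hx₀⟩ := isCompact_univ.exists_isMinOn (Set.univ_nonempty (α := UnitAddCircle))
    (toCₗ s f).continuous.continuousOn
  have hδ : 0 < f x₀ := hf x₀
  have hmin (x : UnitAddCircle) : f x₀ ≤ f x := hx₀ (Set.mem_univ x)
  set K : ℝ := ‖toCₗ s f‖ + 1 with hKdef
  have hK0 : 0 < K := by positivity
  have hK (x : UnitAddCircle) : f x ≤ K :=
    (le_abs_self _).trans (((toCₗ s f).norm_coe_le_norm x).trans (by linarith))
  -- Since `0 < min f ≤ f ≤ K`, the function `1 - f/K` takes values in `[0, 1 - min f / K]`, and the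
  -- upper end is below `1`.
  have hg (x : UnitAddCircle) : |(one s - K⁻¹ • f) x| ≤ 1 - K⁻¹ * f x₀ := by
    rw [sub_apply, smul_apply, one_apply, abs_of_nonneg]
    · have := mul_le_mul_of_nonneg_left (hmin x) (inv_nonneg.2 hK0.le)
      linarith
    · have := mul_le_mul_of_nonneg_left (hK x) (inv_nonneg.2 hK0.le)
      rw [inv_mul_cancel₀ hK0.ne'] at this
      linarith
  have hu := isUnit_one_sub_mulL h _ (by have := mul_pos (inv_pos.2 hK0) hδ; linarith) hg
  have e : 1 - mulL h' (one s - K⁻¹ • f) = K⁻¹ • mulL h' f := by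
    rw [map_sub, mulL_one, map_smul, sub_sub_cancel]
  rw [e] at hu
  have h2 := hu.smul (Units.mk0 K hK0.ne')
  rwa [Units.smul_mk0, smul_smul, mul_inv_cancel₀ hK0.ne', one_smul] at h2

end Sobolev

/-! ### Exponential and logarithm on `H^s(S¹)` -/

namespace Sobolev

variable {s : ℝ}

/-- Evaluation at `x` is continuous, so it may be applied to the operator series term by term, where
it gives the scalar exponential series. -/
theorem exp_mulL_apply (h : 1 / 2 < s) (f u : Sobolev s) (x : UnitAddCircle) :
    NormedSpace.exp (mulL h f) u x = Real.exp (f x) * u x := by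
  have := completeSpace h
  have h1 := NormedSpace.exp_series_hasSum_exp' (𝕂 := ℝ) (mulL h f)
  have h2 := ((eval h x).comp (ContinuousLinearMap.apply ℝ (Sobolev s) u)).hasSum h1
  have h3 := (NormedSpace.exp_series_hasSum_exp' (𝕂 := ℝ) (f x)).mul_right (u x)
  rw [Real.exp_eq_exp_ℝ]
  refine HasSum.unique (h2.congr_fun fun n => ?_) h3 |>.symm ▸ rfl
  change _ = ((n.factorial : ℝ)⁻¹ • (mulL h f ^ n) u) x
  rw [smul_apply, mulL_pow_apply, smul_eq_mul, mul_assoc]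

/-- The exponential `f ↦ e^f` on `H^s(S¹)`, `s > 1/2`. -/
def exp (h : 1 / 2 < s) (f : Sobolev s) : Sobolev s := NormedSpace.exp (mulL h f) (one s)

theorem exp_apply (h : 1 / 2 < s) (f : Sobolev s) (x : UnitAddCircle) :
    exp h f x = Real.exp (f x) := by
  rw [exp, exp_mulL_apply, one_apply, mul_one]

theorem contDiff_exp (h : 1 / 2 < s) (n : ℕ∞ω) : ContDiff ℝ n (exp h) := by
  have := completeSpace h
  have h1 : ContDiff ℝ n
      (NormedSpace.exp : (Sobolev s →L[ℝ] Sobolev s) → (Sobolev s →L[ℝ] Sobolev s)) :=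
    AnalyticOnNhd.contDiff fun x _ => NormedSpace.exp_analytic (𝕂 := ℝ) x
  exact (h1.comp (mulL h).contDiff).clm_apply contDiff_const

/-- The identity `e^g = e^f e^{g - f}` reduces this to the point `0`, where the derivative of the
operator exponential is the identity. -/
theorem hasFDerivAt_exp (h : 1 / 2 < s) (f : Sobolev s) :
    HasFDerivAt (exp h) (mulL h (exp h f)) f := by
  have := completeSpace h
  have h1 : HasFDerivAt (𝕜 := ℝ) (NormedSpace.exp : (Sobolev s →L[ℝ] Sobolev s) → _)
      (1 : (Sobolev s →L[ℝ] Sobolev s) →L[ℝ] (Sobolev s →L[ℝ] Sobolev s)) (mulL h 0) := by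
    rw [map_zero]
    exact hasFDerivAt_exp_zero (𝕂 := ℝ)
  have h0 : HasFDerivAt (exp h) (ContinuousLinearMap.id ℝ (Sobolev s)) 0 := by
    have h2 := (ContinuousLinearMap.apply ℝ (Sobolev s) (one s)).hasFDerivAt.comp 0
      (h1.comp 0 (mulL h).hasFDerivAt)
    refine h2.congr_fderiv ?_
    ext u
    refine ext fun x => ?_
    change mulL h u (one s) x = u x
    rw [mulL_apply, one_apply, mul_one]
  have e : exp h = fun g => mulL h (exp h f) (exp h (g - f)) := by
    funext g
    refine ext fun x => ?_
    rw [mulL_apply, exp_apply, exp_apply, exp_apply, sub_apply, ← Real.exp_add,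
      add_sub_cancel]
  have h3 : HasFDerivAt (fun g : Sobolev s => g - f) (ContinuousLinearMap.id ℝ (Sobolev s)) f :=
    (hasFDerivAt_id f).sub_const f
  rw [← sub_self f] at h0
  have h4 := (mulL h (exp h f)).hasFDerivAt.comp f 
    (HasFDerivAt.comp (f := fun g : Sobolev s => g - f) f h0 h3)
  exact (h4.congr_of_eventuallyEq (Filter.Eventually.of_forall (congrFun e))).congr_fderiv rfl

/-- The integral formula `log f = ∫₀¹ (f - 1) / (1 + t (f - 1)) dt` for the logarithm. -/
def log (h : 1 / 2 < s) (f : Sobolev s) : Sobolev s :=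
  ∫ t in (0 : ℝ)..1, Ring.inverse (mulL h (one s + t • (f - one s))) (f - one s)

/-- For `t ∈ [0, 1]` the function `1 + t (f - 1)` is a convex combination of `1` and `f`, hence
positive, and `isUnit_mulL` makes the inverse in the integrand genuine and continuous in `t`. At `x`
the integrand is the `t`-derivative of `log (1 + t (f x - 1))`. -/
theorem log_apply (h : 3 / 2 < s) (h' : 1 / 2 < s) {f : Sobolev s} (hf : ∀ x, 0 < f x)
    (x : UnitAddCircle) : log h' f x = Real.log (f x) := by
  have := completeSpace h'
  have hpos : ∀ t ∈ Set.Icc (0 : ℝ) 1, ∀ y, 0 < (one s + t • (f - one s)) y := by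
    intro t ht y
    rw [add_apply, smul_apply, sub_apply, one_apply]
    nlinarith [ht.1, ht.2, hf y, mul_nonneg ht.1 (hf y).le]
  have hcont : ContinuousOn (fun t : ℝ =>
      Ring.inverse (mulL h' (one s + t • (f - one s))) (f - one s)) (Set.uIcc 0 1) := by
    rw [Set.uIcc_of_le zero_le_one]
    intro t ht
    obtain ⟨U, hU⟩ := isUnit_mulL h _ (hpos t ht)
    have h1 : ContinuousAt Ring.inverse (mulL h' (one s + t • (f - one s))) := by
      rw [← hU]
      exact NormedRing.inverse_continuousAt U
    have h2 : Continuous fun t : ℝ => mulL h' (one s + t • (f - one s)) := by fun_prop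
    have h3 : ContinuousAt (fun t : ℝ => Ring.inverse (mulL h' (one s + t • (f - one s)))) t :=
      ContinuousAt.comp (f := fun t : ℝ => mulL h' (one s + t • (f - one s))) h1 h2.continuousAt
    exact (h3.clm_apply continuousAt_const).continuousWithinAt
  have h1 := (eval h' x).intervalIntegral_comp_comm
    (hcont.intervalIntegrable (μ := MeasureTheory.volume))
  rw [eval_apply] at h1
  rw [log, ← h1]
  have h2 : ∀ t ∈ Set.uIcc (0 : ℝ) 1,
      eval h' x (Ring.inverse (mulL h' (one s + t • (f - one s))) (f - one s))
        = (f x - 1) / (1 + t * (f x - 1)) := by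
    intro t ht
    rw [Set.uIcc_of_le zero_le_one] at ht
    have h3 := Ring.mul_inverse_cancel _ (isUnit_mulL h _ (hpos t ht))
    have h4 := congrArg (fun T : Sobolev s →L[ℝ] Sobolev s => T (f - one s) x) h3
    simp only [mul_apply_eq_comp, one_apply_eq_self] at h4
    rw [mulL_apply] at h4
    have h5 := hpos t ht x
    rw [add_apply, smul_apply, sub_apply, one_apply] at h4 h5
    rw [eval_apply, eq_div_iff h5.ne', mul_comm]
    exact h4
  rw [intervalIntegral.integral_congr h2]
  have hder : ∀ t ∈ Set.uIcc (0 : ℝ) 1, HasDerivAt (fun t : ℝ => Real.log (1 + t * (f x - 1)))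
      ((f x - 1) / (1 + t * (f x - 1))) t := by
    intro t ht
    rw [Set.uIcc_of_le zero_le_one] at ht
    have h5 := hpos t ht x
    rw [add_apply, smul_apply, sub_apply, one_apply] at h5
    have h6 := (((hasDerivAt_id t).mul_const (f x - 1)).const_add 1).log h5.ne'
    simpa using h6
  have hint : ContinuousOn (fun t : ℝ => (f x - 1) / (1 + t * (f x - 1))) (Set.uIcc 0 1) := by
    refine ContinuousOn.div (by fun_prop) (by fun_prop) fun t ht => ?_
    rw [Set.uIcc_of_le zero_le_one] at ht
    have h5 := hpos t ht x
    rw [add_apply, smul_apply, sub_apply, one_apply] at h5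
    exact h5.ne'
  rw [intervalIntegral.integral_eq_sub_of_hasDerivAt hder hint.intervalIntegrable]
  simp

theorem log_exp (h : 3 / 2 < s) (h' : 1 / 2 < s) (f : Sobolev s) : log h' (exp h' f) = f := by
  refine ext fun x => ?_
  rw [log_apply h h' (fun x => by rw [exp_apply]; exact Real.exp_pos _), exp_apply, Real.log_exp]

theorem exp_log (h : 3 / 2 < s) (h' : 1 / 2 < s) {f : Sobolev s} (hf : ∀ x, 0 < f x) :
    exp h' (log h' f) = f := by
  refine ext fun x => ?_
  rw [exp_apply, log_apply h h' hf, Real.exp_log (hf x)]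

/-- The logarithm is smooth at positive functions, by the inverse function theorem. -/
theorem contDiffAt_log (h : 3 / 2 < s) (h' : 1 / 2 < s) {f : Sobolev s} (hf : ∀ x, 0 < f x) :
    ContDiffAt ℝ ∞ (log h') f := by
  have := completeSpace h'
  set a := log h' f with ha
  have hfa : exp h' a = f := exp_log h h' hf
  -- The derivative of `exp` at `a` is multiplication by `e^a`, inverted by multiplication by
  -- `e^{-a}`.
  let e : Sobolev s ≃L[ℝ] Sobolev s := ContinuousLinearEquiv.equivOfInverse
    (mulL h' (exp h' a)) (mulL h' (exp h' (-a)))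
    (fun u => ext fun x => by
      rw [mulL_apply, mulL_apply, exp_apply, exp_apply, ← mul_assoc, ← Real.exp_add]
      change Real.exp (- a x + a x) * _ = _
      simp)
    (fun u => ext fun x => by
      rw [mulL_apply, mulL_apply, exp_apply, exp_apply, ← mul_assoc, ← Real.exp_add]
      change Real.exp (a x + - a x) * _ = _
      simp)
  have hd : HasFDerivAt (exp h') (e : Sobolev s →L[ℝ] Sobolev s) a := hasFDerivAt_exp h' a
  have hc : ContDiffAt ℝ ∞ (exp h') a := (contDiff_exp h' ∞).contDiffAt
  have hn : (∞ : ℕ∞ω) ≠ 0 := by simp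
  have h1 := hc.to_localInverse hd hn
  rw [hfa] at h1
  refine h1.congr_of_eventuallyEq ?_
  have h2 := (hc.hasStrictFDerivAt' hd hn).eventually_right_inverse
  rw [hfa] at h2
  filter_upwards [h2] with g hg
  -- As `log` is a global left inverse of `exp`, it agrees with the local inverse near `f`.
  have h3 := log_exp h h' (hc.localInverse hd hn g)
  rw [← h3]
  congr 1
  exact hg.symm

end Sobolev

/-! ### Differentiation and integration -/

/-- Integration over `[0, x]`. -/
def integralCL (x : ℝ) : C(UnitAddCircle, ℝ) →L[ℝ] ℝ :=
  LinearMap.mkContinuous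
    { toFun := fun f => ∫ y in (0 : ℝ)..x, f (y : UnitAddCircle)
      map_add' := fun f g => intervalIntegral.integral_add
        ((continuous_lift f).intervalIntegrable 0 x) ((continuous_lift g).intervalIntegrable 0 x)
      map_smul' := fun c f => intervalIntegral.integral_const_mul c _ } |x| (by
    intro f
    have h := intervalIntegral.norm_integral_le_of_norm_le_const (a := 0) (b := x)
      (f := fun y : ℝ => f (y : UnitAddCircle)) (C := ‖f‖) fun y _ => f.norm_coe_le_norm _
    rw [sub_zero, mul_comm] at h
    exact h)

theorem integralCL_apply (x : ℝ) (f : C(UnitAddCircle, ℝ)) :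
    integralCL x f = ∫ y in (0 : ℝ)..x, f (y : UnitAddCircle) := rfl

theorem integralCL_zero (f : C(UnitAddCircle, ℝ)) : integralCL 0 f = 0 := by
  rw [integralCL_apply, intervalIntegral.integral_same]

theorem hasDerivAt_integralCL (f : C(UnitAddCircle, ℝ)) (x : ℝ) :
    HasDerivAt (fun x => integralCL x f) (f x) x :=
  intervalIntegral.integral_hasDerivAt_right ((continuous_lift f).intervalIntegrable 0 x)
    ((continuous_lift f).stronglyMeasurableAtFilter _ _) (continuous_lift f).continuousAt

theorem integralCL_add_one (f : C(UnitAddCircle, ℝ)) (x : ℝ) :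
    integralCL (x + 1) f = integralCL x f + integralCL 1 f := by
  have hp : Function.Periodic (fun y : ℝ => f (y : UnitAddCircle)) 1 := fun y => by
    change f _ = f _
    rw [AddCircle.coe_add_period]
  have h1 := hp.intervalIntegral_add_eq x 0
  rw [zero_add] at h1
  rw [integralCL_apply, integralCL_apply, integralCL_apply, ← h1,
    intervalIntegral.integral_add_adjacent_intervals
    ((continuous_lift f).intervalIntegrable _ _) ((continuous_lift f).intervalIntegrable _ _)]

theorem integralCL_deriv {f g : C(UnitAddCircle, ℝ)}
    (hfg : ∀ x : ℝ, HasDerivAt (fun y : ℝ => f y) (g x) x) (x : ℝ) :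
    integralCL x g = f x - f 0 :=
  intervalIntegral.integral_eq_sub_of_hasDerivAt (fun y _ => hfg y)
    ((continuous_lift g).intervalIntegrable _ _)

/-- The periodic function `x ↦ ∫₀ˣ f - x ∫₀¹ f`. -/
def primitive (f : C(UnitAddCircle, ℝ)) : C(UnitAddCircle, ℝ) where
  toFun := Function.Periodic.lift (f := fun x : ℝ => integralCL x f - x * integralCL 1 f) (c := 1)
    fun x => by
      change integralCL (x + 1) f - (x + 1) * integralCL 1 f = _
      rw [integralCL_add_one]
      ring
  continuous_toFun := by
    refine continuous_coinduced_dom.2 ?_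
    change Continuous fun x : ℝ => integralCL x f - x * integralCL 1 f
    have : Continuous fun x : ℝ => integralCL x f :=
      continuous_iff_continuousAt.2 fun x => (hasDerivAt_integralCL f x).continuousAt
    fun_prop

theorem primitive_apply (f : C(UnitAddCircle, ℝ)) (x : ℝ) :
    primitive f x = integralCL x f - x * integralCL 1 f := rfl

theorem hasDerivAt_primitive (f : C(UnitAddCircle, ℝ)) (x : ℝ) :
    HasDerivAt (fun y : ℝ => primitive f y) ((f - integralCL 1 f • 1 : C(UnitAddCircle, ℝ)) x) x := by
  have h := (hasDerivAt_integralCL f x).sub ((hasDerivAt_id x).mul_const (integralCL 1 f))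
  refine h.congr_deriv ?_
  simp

namespace Sobolev

variable {s : ℝ}

theorem toCₗ_mem (f : Sobolev s) : toCₗ s f ∈ sobolevSubmodule s := f.memℓp

/-- Continuity into `H^{s-1}` needs no further norm estimate: point evaluations of the derivative
are continuous because `exists_deriv` is continuous into `C(S¹)`. -/
theorem exists_derivL (h : 3 / 2 < s) : ∃ D : Sobolev s →L[ℝ] Sobolev (s - 1),
    ∀ (u : Sobolev s) (x : ℝ), HasDerivAt (fun y : ℝ => u y) (D u x) x := by
  obtain ⟨D, hD⟩ := exists_deriv h
  have := completeSpace (show 1 / 2 < s by linarith)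
  let L : Sobolev s →ₗ[ℝ] Sobolev (s - 1) :=
    { toFun := fun u => ofMem (D u) (deriv_mem (hD u) u.toCₗ_mem)
      map_add' := fun u v => ext fun x => by
        simp only [toCₗ_ofMem, map_add]
      map_smul' := fun c u => ext fun x => by
        simp only [toCₗ_ofMem, map_smul, RingHom.id_apply] }
  refine ⟨⟨L, continuous_of_eval (by linarith) L fun x => ?_⟩, hD⟩
  exact (ContinuousMap.evalCLM ℝ x).continuous.comp D.continuous

/-- Differentiation `H^s(S¹) → H^{s-1}(S¹)`, `s > 3/2`. -/
def derivL (h : 3 / 2 < s) : Sobolev s →L[ℝ] Sobolev (s - 1) := (exists_derivL h).choose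

theorem hasDerivAt_derivL (h : 3 / 2 < s) (u : Sobolev s) (x : ℝ) :
    HasDerivAt (fun y : ℝ => u y) (derivL h u x) x := (exists_derivL h).choose_spec u x

theorem exists_primitiveL (h : 3 / 2 < s) : ∃ P : Sobolev (s - 1) →L[ℝ] Sobolev0 s,
    ∀ (f : Sobolev (s - 1)) (x : ℝ), (P f : Sobolev s) x
      = integralCL x (toCₗ (s - 1) f) - x * integralCL 1 (toCₗ (s - 1) f) := by
  have h1 : 1 / 2 < s - 1 := by linarith
  have := completeSpace h1
  have hmem (f : Sobolev (s - 1)) : primitive (toCₗ (s - 1) f) ∈ sobolevSubmodule s :=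
    mem_of_deriv_mem (hasDerivAt_primitive _)
      (Submodule.sub_mem _ f.toCₗ_mem (Submodule.smul_mem _ _ (one_mem _)))
  let L : Sobolev (s - 1) →ₗ[ℝ] Sobolev s :=
    { toFun := fun f => ofMem _ (hmem f)
      map_add' := fun f g => ext <| circle_forall fun x => by
        simp only [toCₗ_ofMem, ContinuousMap.add_apply, primitive_apply, map_add]
        ring
      map_smul' := fun c f => ext <| circle_forall fun x => by
        simp only [toCₗ_ofMem, ContinuousMap.smul_apply, primitive_apply, map_smul,
          RingHom.id_apply, smul_eq_mul]
        ring }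
  have hL : Continuous L := by
    refine continuous_of_eval (by linarith) L (circle_forall fun x => ?_)
    change Continuous fun f : Sobolev (s - 1) =>
      integralCL x (toC h1 f) - x * integralCL 1 (toC h1 f)
    fun_prop
  refine ⟨(⟨L, hL⟩ : Sobolev (s - 1) →L[ℝ] Sobolev s).codRestrict (Sobolev0 s) fun f => ?_,
    fun f x => rfl⟩
  change primitive (toCₗ (s - 1) f) ((0 : ℝ) : UnitAddCircle) = 0
  rw [primitive_apply, integralCL_zero, zero_mul, sub_zero]

/-- The primitive vanishing at `0` of the mean-free part, `H^{s-1}(S¹) → H_0^s(S¹)`. -/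
def primitiveL (h : 3 / 2 < s) : Sobolev (s - 1) →L[ℝ] Sobolev0 s := (exists_primitiveL h).choose

theorem primitiveL_apply (h : 3 / 2 < s) (f : Sobolev (s - 1)) (x : ℝ) :
    (primitiveL h f : Sobolev s) x
      = integralCL x (toCₗ (s - 1) f) - x * integralCL 1 (toCₗ (s - 1) f) :=
  (exists_primitiveL h).choose_spec f x

end Sobolev

theorem lorentz_toL2 {s : ℝ} (f g : Sobolev s × Sobolev s) : lorentz (toL2 f) (toL2 g)
    = ∫ x in (0 : ℝ)..1, (f.1 x * g.1 x - f.2 x * g.2 x) := by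
  have h := AddCircle.intervalIntegral_preimage 1 0
    fun x : UnitAddCircle => f.1 x * g.1 x - f.2 x * g.2 x
  rw [zero_add] at h
  rw [h, lorentz]
  have hc := fun F : C(UnitAddCircle, ℝ) => ContinuousMap.coeFn_toLp (p := 2) (𝕜 := ℝ)
    (MeasureTheory.volume : MeasureTheory.Measure UnitAddCircle) F
  refine MeasureTheory.integral_congr_ae ?_
  filter_upwards [hc (Sobolev.toCₗ s f.1), hc (Sobolev.toCₗ s f.2), hc (Sobolev.toCₗ s g.1),
    hc (Sobolev.toCₗ s g.2)] with x h1 h2 h3 h4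
  simp only [toL2, h1, h2, h3, h4]

/-! ### The map `Φ` and its inverse between open subsets of the ambient spaces -/

open Sobolev

variable {s : ℝ} (hs : 5 / 2 < s)

/-- The function `φ_x`, of class `H^{s-1}`. -/
def jac (g : Sobolev0 s × Sobolev (s - 1)) : Sobolev (s - 1) :=
  one (s - 1) + derivL (by linarith : 3 / 2 < s) (g.1 : Sobolev s)

theorem hasDerivAt_liftG (g : Sobolev0 s × Sobolev (s - 1)) (x : ℝ) :
    HasDerivAt (liftG g).1 (jac hs g x) x :=
  (hasDerivAt_id x).add (hasDerivAt_derivL (by linarith : 3 / 2 < s) (g.1 : Sobolev s) x)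

theorem mem_G_iff {g : Sobolev0 s × Sobolev (s - 1)} :
    g ∈ G s hs ↔ ∀ x : UnitAddCircle, 0 < jac hs g x := by
  change (∀ x : ℝ, 0 < deriv (liftG g).1 x) ↔ _
  simp only [(hasDerivAt_liftG hs g _).deriv]
  exact ⟨fun h => circle_forall h, fun h x => h x⟩

theorem contDiff_jac (n : ℕ∞ω) : ContDiff ℝ n (jac hs) :=
  contDiff_const.add ((derivL _).contDiff.comp
    ((Sobolev0 s).subtypeL.contDiff.comp contDiff_fst))

/-- The function `e^{(p + α) / 2}`, where `e^p = φ_x`. -/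
def phiExp (α : Sobolev (s - 1)) (g : Sobolev0 s × Sobolev (s - 1)) : Sobolev (s - 1) :=
  exp (half_lt_sub_one hs) ((1 / 2 : ℝ) • (log (half_lt_sub_one hs) (jac hs g) + α))

theorem phiExp_apply {g : Sobolev0 s × Sobolev (s - 1)} (hg : g ∈ G s hs) (α : Sobolev (s - 1))
    (x : UnitAddCircle) : phiExp hs α g x = √(jac hs g x) * Real.exp (α x / 2) := by
  have hj := (mem_G_iff hs).1 hg
  rw [phiExp, exp_apply, smul_apply, add_apply,
    log_apply (by linarith : 3 / 2 < s - 1) (half_lt_sub_one hs) hj, mul_add, Real.exp_add,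
    one_div_mul_eq_div, one_div_mul_eq_div, Real.exp_half, Real.exp_log (hj x)]

/-- The formula of `Φ`, as a map between the ambient spaces. -/
def phiFun (g : Sobolev0 s × Sobolev (s - 1)) : Sobolev (s - 1) × Sobolev (s - 1) :=
  ((1 / 2 : ℝ) • (phiExp hs g.2 g + phiExp hs (-g.2) g),
    (1 / 2 : ℝ) • (phiExp hs g.2 g - phiExp hs (-g.2) g))

theorem neg_apply (f : Sobolev s) (x : UnitAddCircle) : (-f) x = -f x := rfl

theorem phiFun_fst_apply {g : Sobolev0 s × Sobolev (s - 1)} (hg : g ∈ G s hs) (x : UnitAddCircle) :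
    (phiFun hs g).1 x = √(jac hs g x) * Real.cosh (g.2 x / 2) := by
  simp only [phiFun, smul_apply, add_apply, phiExp_apply hs hg, neg_apply, Real.cosh_eq, neg_div]
  ring

theorem phiFun_snd_apply {g : Sobolev0 s × Sobolev (s - 1)} (hg : g ∈ G s hs) (x : UnitAddCircle) :
    (phiFun hs g).2 x = √(jac hs g x) * Real.sinh (g.2 x / 2) := by
  simp only [phiFun, smul_apply, sub_apply, phiExp_apply hs hg, neg_apply, Real.sinh_eq, neg_div]
  ring

theorem contDiffAt_phiExp {g : Sobolev0 s × Sobolev (s - 1)} (hg : g ∈ G s hs)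
    {α : Sobolev0 s × Sobolev (s - 1) → Sobolev (s - 1)} (hα : ContDiff ℝ ∞ α) :
    ContDiffAt ℝ ∞ (fun g => phiExp hs (α g) g) g := by
  have h1 : ContDiffAt ℝ ∞ (fun g => log (half_lt_sub_one hs) (jac hs g)) g :=
    ContDiffAt.comp (f := jac hs) g
      (contDiffAt_log (by linarith : 3 / 2 < s - 1) (half_lt_sub_one hs) ((mem_G_iff hs).1 hg))
      (contDiff_jac hs ∞).contDiffAt
  exact (contDiff_exp (half_lt_sub_one hs) ∞).contDiffAt.comp g
    ((h1.add hα.contDiffAt).const_smul (1 / 2 : ℝ))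

theorem contDiffAt_phiFun {g : Sobolev0 s × Sobolev (s - 1)} (hg : g ∈ G s hs) :
    ContDiffAt ℝ ∞ (phiFun hs) g := by
  have h1 := contDiffAt_phiExp hs hg contDiff_snd
  have h2 := contDiffAt_phiExp hs hg contDiff_snd.neg
  exact ((h1.add h2).const_smul (1 / 2 : ℝ)).prodMk ((h1.sub h2).const_smul (1 / 2 : ℝ))

/-- The function `f₁² - f₂²`. -/
def sqDiff (f : Sobolev (s - 1) × Sobolev (s - 1)) : Sobolev (s - 1) :=
  mulL (half_lt_sub_one hs) f.1 f.1 - mulL (half_lt_sub_one hs) f.2 f.2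

theorem sqDiff_apply (f : Sobolev (s - 1) × Sobolev (s - 1)) (x : UnitAddCircle) :
    sqDiff hs f x = f.1 x ^ 2 - f.2 x ^ 2 := by
  rw [sqDiff, sub_apply, mulL_apply, mulL_apply, sq, sq]

theorem lorentz_eq_integralCL (f : Sobolev (s - 1) × Sobolev (s - 1)) :
    lorentz (toL2 f) (toL2 f) = integralCL 1 (toCₗ (s - 1) (sqDiff hs f)) := by
  simp only [lorentz_toL2, integralCL_apply, sqDiff_apply, sq]

/-- The formula of `Φ⁻¹`, as a map between the ambient spaces. -/
def psiFun (f : Sobolev (s - 1) × Sobolev (s - 1)) : Sobolev0 s × Sobolev (s - 1) :=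
  (primitiveL (by linarith : 3 / 2 < s) (sqDiff hs f),
    log (half_lt_sub_one hs) (f.1 + f.2) - log (half_lt_sub_one hs) (f.1 - f.2))

/-- The two factors of `a² - b²` have the same sign, and their sum is `2a > 0`. This makes both
logarithms in `psiFun` legitimate. -/
theorem add_pos_and_sub_pos {a b : ℝ} (h : 0 < a ∧ 0 < a ^ 2 - b ^ 2) : 0 < a + b ∧ 0 < a - b := by
  constructor <;> nlinarith [h.1, h.2]

theorem psiFun_snd_apply {f : Sobolev (s - 1) × Sobolev (s - 1)}
    (hf : ∀ x, 0 < f.1 x ∧ 0 < f.1 x ^ 2 - f.2 x ^ 2) (x : UnitAddCircle) :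
    (psiFun hs f).2 x = Real.log (f.1 x + f.2 x) - Real.log (f.1 x - f.2 x) := by
  have h := fun x => add_pos_and_sub_pos (hf x)
  rw [psiFun, sub_apply, log_apply (by linarith : 3 / 2 < s - 1) (half_lt_sub_one hs)
    (fun x => (h x).1), log_apply (by linarith : 3 / 2 < s - 1) (half_lt_sub_one hs)
    (fun x => (h x).2)]
  rfl

theorem contDiffAt_psiFun {f : Sobolev (s - 1) × Sobolev (s - 1)}
    (hf : ∀ x, 0 < f.1 x ∧ 0 < f.1 x ^ 2 - f.2 x ^ 2) : ContDiffAt ℝ ∞ (psiFun hs) f := by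
  have h := fun x => add_pos_and_sub_pos (hf x)
  have hlog {f : Sobolev (s - 1)} (hf : ∀ x, 0 < f x) :=
    contDiffAt_log (by linarith : 3 / 2 < s - 1) (half_lt_sub_one hs) hf
  have hq : ContDiff ℝ ∞ (sqDiff hs) :=
    (((mulL _).contDiff.comp contDiff_fst).clm_apply contDiff_fst).sub
      (((mulL _).contDiff.comp contDiff_snd).clm_apply contDiff_snd)
  have h1 : ContDiffAt ℝ ∞ (fun f : Sobolev (s - 1) × Sobolev (s - 1) =>
      log (half_lt_sub_one hs) (f.1 + f.2)) f :=
    ContDiffAt.comp (f := fun f : Sobolev (s - 1) × Sobolev (s - 1) => f.1 + f.2) f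
      (hlog fun x => (h x).1) (contDiff_fst.add contDiff_snd).contDiffAt
  have h2 : ContDiffAt ℝ ∞ (fun f : Sobolev (s - 1) × Sobolev (s - 1) =>
      log (half_lt_sub_one hs) (f.1 - f.2)) f :=
    ContDiffAt.comp (f := fun f : Sobolev (s - 1) × Sobolev (s - 1) => f.1 - f.2) f
      (hlog fun x => (h x).2) (contDiff_fst.sub contDiff_snd).contDiffAt
  exact ((primitiveL _).contDiff.comp hq).contDiffAt.prodMk (h1.sub h2)

theorem sqDiff_phiFun {g : Sobolev0 s × Sobolev (s - 1)} (hg : g ∈ G s hs) :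
    sqDiff hs (phiFun hs g) = jac hs g := Sobolev.ext fun x => by
  rw [sqDiff_apply, phiFun_fst_apply hs hg, phiFun_snd_apply hs hg, mul_pow, mul_pow, ← mul_sub,
    Real.cosh_sq_sub_sinh_sq, Real.sq_sqrt ((mem_G_iff hs).1 hg x).le, mul_one]

theorem integralCL_jac (g : Sobolev0 s × Sobolev (s - 1)) (x : ℝ) :
    integralCL x (toCₗ (s - 1) (jac hs g)) = x + (g.1 : Sobolev s) x := by
  have h0 : (g.1 : Sobolev s) 0 = 0 := g.1.2
  have h1 : integralCL x (toCₗ (s - 1) (one (s - 1))) = x := by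
    rw [integralCL_apply]
    simp only [one_apply]
    simp
  rw [jac, map_add, map_add, h1,
    integralCL_deriv (hasDerivAt_derivL (by linarith : 3 / 2 < s) (g.1 : Sobolev s)), h0, sub_zero]

theorem integralCL_one_jac (g : Sobolev0 s × Sobolev (s - 1)) :
    integralCL 1 (toCₗ (s - 1) (jac hs g)) = 1 := by
  have h0 : (g.1 : Sobolev s) 0 = 0 := g.1.2
  rw [integralCL_jac, circle_one_eq_zero, QuotientAddGroup.mk_zero, h0, add_zero]

theorem phiFun_mem {g : Sobolev0 s × Sobolev (s - 1)} (hg : g ∈ G s hs) :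
    toL2 (phiFun hs g) ∈ pseudosphereL2 := by
  change lorentz _ _ = 1
  rw [lorentz_eq_integralCL hs, sqDiff_phiFun hs hg, integralCL_one_jac]

theorem phiFun_pos {g : Sobolev0 s × Sobolev (s - 1)} (hg : g ∈ G s hs) (x : UnitAddCircle) :
    0 < (phiFun hs g).1 x ∧ 0 < (phiFun hs g).1 x ^ 2 - (phiFun hs g).2 x ^ 2 := by
  have hj := (mem_G_iff hs).1 hg x
  rw [← sqDiff_apply hs, sqDiff_phiFun hs hg, phiFun_fst_apply hs hg]
  exact ⟨mul_pos (Real.sqrt_pos.2 hj) (Real.cosh_pos _), hj⟩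

theorem psiFun_phiFun {g : Sobolev0 s × Sobolev (s - 1)} (hg : g ∈ G s hs) :
    psiFun hs (phiFun hs g) = g := by
  refine Prod.ext (Subtype.ext (Sobolev.ext (circle_forall fun x => ?_))) (Sobolev.ext fun x => ?_)
  · change (primitiveL _ (sqDiff hs (phiFun hs g)) : Sobolev s) x = _
    rw [primitiveL_apply, sqDiff_phiFun hs hg, integralCL_one_jac, integralCL_jac]
    ring
  · rw [psiFun_snd_apply hs (phiFun_pos hs hg), phiFun_fst_apply hs hg, phiFun_snd_apply hs hg,
      ← mul_add, ← mul_sub, Real.cosh_add_sinh, Real.cosh_sub_sinh]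
    have hj := Real.sqrt_pos.2 ((mem_G_iff hs).1 hg x)
    rw [Real.log_mul hj.ne' (Real.exp_ne_zero _), Real.log_mul hj.ne' (Real.exp_ne_zero _),
      Real.log_exp, Real.log_exp]
    ring

/-- The normalisation `∫ (f₁² - f₂²) = 1` makes the linear correction in `primitiveL` equal to `-x`,
which cancels the identity in the lift and leaves `∫₀ˣ (f₁² - f₂²)`. -/
theorem jac_psiFun {f : Sobolev (s - 1) × Sobolev (s - 1)} (hf : lorentz (toL2 f) (toL2 f) = 1) :
    jac hs (psiFun hs f) = sqDiff hs f := by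
  refine Sobolev.ext (circle_forall fun x => ?_)
  refine (hasDerivAt_liftG hs (psiFun hs f) x).unique ?_
  rw [lorentz_eq_integralCL hs] at hf
  refine (hasDerivAt_integralCL (toCₗ (s - 1) (sqDiff hs f)) x).congr_of_eventuallyEq
    (Filter.Eventually.of_forall fun y => ?_)
  change y + (primitiveL _ (sqDiff hs f) : Sobolev s) y = _
  rw [primitiveL_apply, hf]
  ring

theorem psiFun_mem {f : Sobolev (s - 1) × Sobolev (s - 1)} (h1 : lorentz (toL2 f) (toL2 f) = 1)
    (hf : ∀ x, 0 < f.1 x ∧ 0 < f.1 x ^ 2 - f.2 x ^ 2) : psiFun hs f ∈ G s hs := by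
  rw [mem_G_iff, jac_psiFun hs h1]
  intro x
  rw [sqDiff_apply]
  exact (hf x).2

/-- With `a = f₁ + f₂` and `b = f₁ - f₂` one has `e^α = a / b` and `φ_x = a b`, so `√φ_x e^{±α/2}`
is `a`, respectively `b`. -/
theorem phiFun_psiFun {f : Sobolev (s - 1) × Sobolev (s - 1)} (h1 : lorentz (toL2 f) (toL2 f) = 1)
    (hf : ∀ x, 0 < f.1 x ∧ 0 < f.1 x ^ 2 - f.2 x ^ 2) : phiFun hs (psiFun hs f) = f := by
  have key (x : UnitAddCircle) : √(f.1 x ^ 2 - f.2 x ^ 2) * Real.exp ((psiFun hs f).2 x / 2)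
      = f.1 x + f.2 x ∧ √(f.1 x ^ 2 - f.2 x ^ 2) * Real.exp (-(psiFun hs f).2 x / 2)
      = f.1 x - f.2 x := by
    obtain ⟨ha, hb⟩ := add_pos_and_sub_pos (hf x)
    have e : f.1 x ^ 2 - f.2 x ^ 2 = (f.1 x + f.2 x) * (f.1 x - f.2 x) := by ring
    rw [psiFun_snd_apply hs hf, e, Real.exp_half, Real.exp_half, neg_sub, Real.exp_sub,
      Real.exp_sub, Real.exp_log ha, Real.exp_log hb, ← Real.sqrt_mul (by positivity),
      ← Real.sqrt_mul (by positivity)]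
    constructor
    · rw [Real.sqrt_eq_iff_mul_self_eq_of_pos ha]
      field_simp
    · rw [Real.sqrt_eq_iff_mul_self_eq_of_pos hb]
      field_simp
  have hm := psiFun_mem hs h1 hf
  refine Prod.ext (Sobolev.ext fun x => ?_) (Sobolev.ext fun x => ?_)
  · rw [phiFun_fst_apply hs hm, jac_psiFun hs h1, sqDiff_apply, Real.cosh_eq, ← neg_div]
    linarith [(key x).1, (key x).2]
  · rw [phiFun_snd_apply hs hm, jac_psiFun hs h1, sqDiff_apply, Real.sinh_eq, ← neg_div]
    linarith [(key x).1, (key x).2]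

theorem psiFun_snd_eq_artanh {f : Sobolev (s - 1) × Sobolev (s - 1)}
    (hf : ∀ x, 0 < f.1 x ∧ 0 < f.1 x ^ 2 - f.2 x ^ 2) (x : UnitAddCircle) :
    (psiFun hs f).2 x = 2 * Real.artanh (f.2 x / f.1 x) := by
  obtain ⟨ha, hb⟩ := add_pos_and_sub_pos (hf x)
  have h1 := (hf x).1
  rw [psiFun_snd_apply hs hf, Real.artanh_eq_half_log, ← Real.log_div ha.ne' hb.ne']
  · have : (1 + f.2 x / f.1 x) / (1 - f.2 x / f.1 x) = (f.1 x + f.2 x) / (f.1 x - f.2 x) := by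
      have : f.1 x * (1 - f.2 x / f.1 x) = f.1 x - f.2 x := by field_simp
      rw [← this, ← mul_div_mul_left _ _ h1.ne']
      congr 1
      field_simp
    rw [this]
    ring
  · rw [Set.mem_Icc, le_div_iff₀ h1, div_le_iff₀ h1]
    constructor <;> linarith

/-! ### The diffeomorphism -/

/-- The map `Φ` with values in the pseudosphere. -/
def phiSphere (g : G s hs) : Pseudosphere (s - 1) (half_lt_sub_one hs) :=
  ⟨phiFun hs g, phiFun_mem hs g.2⟩

theorem contMDiff_phiFun : ContMDiff 𝓘(ℝ, Sobolev0 s × Sobolev (s - 1))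
    𝓘(ℝ, Sobolev (s - 1) × Sobolev (s - 1)) ∞ fun g : G s hs => phiFun hs g := fun g =>
  contMDiffAt_subtype_iff.2 (contDiffAt_phiFun hs g.2).contMDiffAt

theorem contMDiff_phiSphere : ContMDiff 𝓘(ℝ, Sobolev0 s × Sobolev (s - 1))
    𝓘(ℝ, PseudosphereModel (s - 1) (half_lt_sub_one hs)) ∞ (phiSphere hs) :=
  quadric_contMDiff_codRestrict (lorentzL (half_lt_sub_one hs)) (lorentzL_symm (half_lt_sub_one hs))
    {f : Sobolev (s - 1) × Sobolev (s - 1) | toL2 f ∈ pseudosphereL2}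
    (fun f => by rw [lorentzL_apply]; rfl) (basePoint (s - 1))
    (lorentzL_basePoint (half_lt_sub_one hs)) ∞ (phiSphere hs) (contMDiff_phiFun hs)

theorem contMDiff_inclU {r : ℝ} {hr : 1 / 2 < r} :
    ContMDiff 𝓘(ℝ, PseudosphereModel r hr) 𝓘(ℝ, Sobolev r × Sobolev r) ∞
      (inclU : pseudosphereU r hr → _) := by
  have h : ContMDiff 𝓘(ℝ, PseudosphereModel r hr) 𝓘(ℝ, Sobolev r × Sobolev r) ∞
      (Pseudosphere.incl : Pseudosphere r hr → _) :=
    quadric_contMDiff_coe (lorentzL hr) (lorentzL_symm hr)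
      {f : Sobolev r × Sobolev r | toL2 f ∈ pseudosphereL2}
      (fun f => by rw [lorentzL_apply]; rfl) (basePoint r) (lorentzL_basePoint hr) ∞
  exact h.comp contMDiff_subtype_val

theorem inclU_pos {r : ℝ} {hr : 1 / 2 < r} (f : pseudosphereU r hr) (x : UnitAddCircle) :
    0 < (inclU f).1 x ∧ 0 < (inclU f).1 x ^ 2 - (inclU f).2 x ^ 2 := f.2 x

theorem lorentz_inclU {r : ℝ} {hr : 1 / 2 < r} (f : pseudosphereU r hr) :
    lorentz (toL2 (inclU f)) (toL2 (inclU f)) = 1 := (f : Pseudosphere r hr).2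

/-- The diffeomorphism `Φ` of `G^s` onto `𝒰^{s-1}`. -/
def phiDiffeo : G s hs ≃ₘ^∞⟮𝓘(ℝ, Sobolev0 s × Sobolev (s - 1)),
    𝓘(ℝ, PseudosphereModel (s - 1) (half_lt_sub_one hs))⟯
    pseudosphereU (s - 1) (half_lt_sub_one hs) where
  toFun g := ⟨phiSphere hs g, fun x => phiFun_pos hs g.2 x⟩
  invFun f := ⟨psiFun hs (inclU f), psiFun_mem hs (lorentz_inclU f) (inclU_pos f)⟩
  left_inv g := Subtype.ext (psiFun_phiFun hs g.2)
  right_inv f := Subtype.ext (Subtype.ext (phiFun_psiFun hs (lorentz_inclU f) (inclU_pos f)))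
  contMDiff_toFun := (ContMDiff.subtypeVal_comp_iff _ _).1 (contMDiff_phiSphere hs)
  -- The ambient formula `psiFun` is smooth at each point of the image, so no chart of the
  -- pseudosphere is needed: it is composed with the smooth inclusion.
  contMDiff_invFun := (ContMDiff.subtypeVal_comp_iff _ _).1 fun f =>
    ContMDiffAt.comp (g := psiFun hs) f (contDiffAt_psiFun hs (inclU_pos f)).contMDiffAt
      (contMDiff_inclU f)

theorem inclU_phiDiffeo (g : G s hs) : inclU (phiDiffeo hs g) = phiFun hs g := rfl

/-! ### The isometry property -/

/-- The chart of an open subset is the inclusion itself, so the inclusion read in charts is the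
identity near the point. -/
theorem hasMFDerivAt_opens_val {E : Type*} [NormedAddCommGroup E] [NormedSpace ℝ E]
    (U : TopologicalSpace.Opens E) (x : U) :
    HasMFDerivAt 𝓘(ℝ, E) 𝓘(ℝ, E) (Subtype.val : U → E) x (ContinuousLinearMap.id ℝ E) := by
  refine ⟨continuous_subtype_val.continuousAt, ?_⟩
  refine HasFDerivAt.hasFDerivWithinAt ?_
  refine (hasFDerivAt_id _).congr_of_eventuallyEq ?_
  filter_upwards [extChartAt_target_mem_nhds (I := 𝓘(ℝ, E)) x] with y hy
  exact (extChartAt 𝓘(ℝ, E) x).right_inv hy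

/-- The composite is also `phiFun` restricted to `G s hs`; the chain rule on both sides and
uniqueness of the derivative remove the stereographic charts from the isometry. -/
theorem mfderiv_inclU_phiDiffeo (g : G s hs)
    (X : TangentSpace 𝓘(ℝ, Sobolev0 s × Sobolev (s - 1)) g) :
    mfderiv 𝓘(ℝ, PseudosphereModel (s - 1) (half_lt_sub_one hs))
      𝓘(ℝ, Sobolev (s - 1) × Sobolev (s - 1)) inclU (phiDiffeo hs g)
      (mfderiv 𝓘(ℝ, Sobolev0 s × Sobolev (s - 1))
        𝓘(ℝ, PseudosphereModel (s - 1) (half_lt_sub_one hs)) (phiDiffeo hs) g X)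
      = fderiv ℝ (phiFun hs) g X := by
  have hn : (∞ : ℕ∞ω) ≠ 0 := by simp
  have h1 := ((contMDiff_inclU (phiDiffeo hs g)).mdifferentiableAt hn).hasMFDerivAt.comp g
    (((phiDiffeo hs).contMDiff g).mdifferentiableAt hn).hasMFDerivAt
  have h2 := ((contDiffAt_phiFun hs g.2).differentiableAt hn).hasFDerivAt.hasMFDerivAt.comp g
    (hasMFDerivAt_opens_val (G s hs) g)
  exact congrArg (fun L => L X) (hasMFDerivAt_unique h1 h2)

theorem jac_add_smul (g X : Sobolev0 s × Sobolev (s - 1)) (t : ℝ) (x : UnitAddCircle) :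
    jac hs (g + t • X) x
      = jac hs g x + t * derivL (by linarith : 3 / 2 < s) (X.1 : Sobolev s) x := by
  simp only [jac, Prod.fst_add, Prod.smul_fst, Submodule.coe_add, Submodule.coe_smul, map_add,
    map_smul, ContinuousMap.add_apply, ContinuousMap.smul_apply,
    smul_eq_mul, add_assoc]

/-- Evaluation at `x` is continuous and linear, so it commutes with differentiation along `t ↦ g + t
X` and leaves a scalar derivative. The pointwise formula for `phiFun` is known only on `G s hs`,
which is open and so contains the line for small `t`. -/
theorem fderiv_phiFun_apply {g : Sobolev0 s × Sobolev (s - 1)} (hg : g ∈ G s hs)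
    (X : Sobolev0 s × Sobolev (s - 1)) (x : UnitAddCircle) :
    (fderiv ℝ (phiFun hs) g X).1 x
      = derivL (by linarith : 3 / 2 < s) (X.1 : Sobolev s) x / (2 * √(jac hs g x)) *
          Real.cosh (g.2 x / 2) + √(jac hs g x) * (Real.sinh (g.2 x / 2) * (X.2 x / 2)) ∧
    (fderiv ℝ (phiFun hs) g X).2 x
      = derivL (by linarith : 3 / 2 < s) (X.1 : Sobolev s) x / (2 * √(jac hs g x)) *
          Real.sinh (g.2 x / 2) + √(jac hs g x) * (Real.cosh (g.2 x / 2) * (X.2 x / 2)) := by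
  have hn : (∞ : ℕ∞ω) ≠ 0 := by simp
  have hline : HasDerivAt (fun t : ℝ => g + t • X) X 0 := by
    simpa using ((hasDerivAt_id (0 : ℝ)).smul_const X).const_add g
  have hg0 : g + (0 : ℝ) • X = g := by simp
  have hphi : HasDerivAt (fun t : ℝ => phiFun hs (g + t • X)) (fderiv ℝ (phiFun hs) g X) 0 := by
    have h1 := ((contDiffAt_phiFun hs hg).differentiableAt hn).hasFDerivAt
    rw [← hg0] at h1
    have h2 := h1.comp_hasDerivAt 0 hline
    rw [hg0] at h2
    exact h2
  have hG : ∀ᶠ t : ℝ in 𝓝 0, g + t • X ∈ G s hs := by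
    refine hline.continuousAt.eventually_mem ((G s hs).isOpen.mem_nhds ?_)
    rw [hg0]
    exact hg
  have hj : HasDerivAt (fun t : ℝ => √(jac hs (g + t • X) x))
      (derivL (by linarith : 3 / 2 < s) (X.1 : Sobolev s) x / (2 * √(jac hs g x))) 0 := by
    simp only [jac_add_smul]
    have h1 := (((hasDerivAt_id (0 : ℝ)).mul_const
      (derivL (by linarith : 3 / 2 < s) (X.1 : Sobolev s) x)).const_add (jac hs g x)).sqrt
      (by simpa using ((mem_G_iff hs).1 hg x).ne')
    simpa using h1
  have ha : HasDerivAt (fun t : ℝ => (g + t • X).2 x / 2) (X.2 x / 2) 0 := by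
    have h1 := (((hasDerivAt_id (0 : ℝ)).mul_const (X.2 x)).const_add (g.2 x)).div_const 2
    simp only [one_mul] at h1
    exact h1
  have hc1 := ((eval (half_lt_sub_one hs) x).comp
    (ContinuousLinearMap.fst ℝ (Sobolev (s - 1)) (Sobolev (s - 1)))).hasFDerivAt.comp_hasDerivAt
    0 hphi
  have hc2 := ((eval (half_lt_sub_one hs) x).comp
    (ContinuousLinearMap.snd ℝ (Sobolev (s - 1)) (Sobolev (s - 1)))).hasFDerivAt.comp_hasDerivAt
    0 hphi
  have hd1 := hj.mul ha.cosh
  have hd2 := hj.mul ha.sinh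
  rw [hg0] at hd1 hd2
  constructor
  · refine hc1.unique (hd1.congr_of_eventuallyEq ?_)
    filter_upwards [hG] with t ht
    exact phiFun_fst_apply hs ht x
  · refine hc2.unique (hd2.congr_of_eventuallyEq ?_)
    filter_upwards [hG] with t ht
    exact phiFun_snd_apply hs ht x

/-- The mixed terms cancel and `cosh² - sinh² = 1` removes `α`. The factor `φ_x` is kept outside,
ready for the substitution `y = φ(x)`. -/
theorem lorentz_fderiv_phiFun {g : Sobolev0 s × Sobolev (s - 1)} (hg : g ∈ G s hs)
    (X Y : Sobolev0 s × Sobolev (s - 1)) :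
    lorentz (toL2 (fderiv ℝ (phiFun hs) g X)) (toL2 (fderiv ℝ (phiFun hs) g Y))
      = 1 / 4 * ∫ x in (0 : ℝ)..1,
        (derivL (by linarith : 3 / 2 < s) (X.1 : Sobolev s) x / jac hs g x *
          (derivL (by linarith : 3 / 2 < s) (Y.1 : Sobolev s) x / jac hs g x) -
          X.2 x * Y.2 x) * jac hs g x := by
  rw [lorentz_toL2, ← intervalIntegral.integral_const_mul]
  congr 1
  funext x
  rw [(fderiv_phiFun_apply hs hg X x).1, (fderiv_phiFun_apply hs hg X x).2,
    (fderiv_phiFun_apply hs hg Y x).1, (fderiv_phiFun_apply hs hg Y x).2]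
  have hj := (mem_G_iff hs).1 hg x
  have hr := Real.sqrt_pos.2 hj
  have hq : √(jac hs g x) ^ 2 = jac hs g x := Real.sq_sqrt hj.le
  have hcs := Real.cosh_sq_sub_sinh_sq (g.2 x / 2)
  generalize √(jac hs g x) = r at *
  rw [← hq]
  generalize Real.cosh (g.2 x / 2) = c at *
  generalize Real.sinh (g.2 x / 2) = d at *
  have hcs' : c ^ 2 = 1 + d ^ 2 := by linarith
  field_simp
  ring_nf
  rw [hcs']
  ring

/-- The lift is strictly increasing, and surjective because it differs from the identity by a
bounded continuous function. -/
theorem exists_homeomorph_liftG {g : Sobolev0 s × Sobolev (s - 1)} (hg : g ∈ G s hs) :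
    ∃ φ : ℝ ≃ₜ ℝ, ⇑φ = (liftG g).1 := by
  have hmono : StrictMono (liftG g).1 := strictMono_of_deriv_pos hg
  have hcont : Continuous (liftG g).1 :=
    continuous_iff_continuousAt.2 fun x => (hasDerivAt_liftG hs g x).continuousAt
  have hb := fun x : ℝ => abs_le.1 ((toCₗ s (g.1 : Sobolev s)).norm_coe_le_norm x)
  have hsurj : Function.Surjective (liftG g).1 := hcont.surjective
    (Filter.tendsto_atTop_add_right_of_le _ _ Filter.tendsto_id fun x => (hb x).1)
    (Filter.tendsto_atBot_add_right_of_ge _ _ Filter.tendsto_id fun x => (hb x).2)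
  exact ⟨(hmono.orderIsoOfSurjective _ hsurj).toHomeomorph, rfl⟩

/-- Right translation gives `(X₁ ∘ φ⁻¹)' = (X₁' / φ_x) ∘ φ⁻¹`; the substitution `y = φ(x)` maps `[0,
1]` to itself because `φ` fixes `0` and `1`. -/
theorem metricG_eq (g : G s hs) (X Y : Sobolev0 s × Sobolev (s - 1)) :
    metricG (-1) g X Y = 1 / 4 * ∫ x in (0 : ℝ)..1,
      (derivL (by linarith : 3 / 2 < s) (X.1 : Sobolev s) x / jac hs g.1 x *
        (derivL (by linarith : 3 / 2 < s) (Y.1 : Sobolev s) x / jac hs g.1 x) -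
        X.2 x * Y.2 x) * jac hs g.1 x := by
  obtain ⟨φ, hφ⟩ := exists_homeomorph_liftG hs g.2
  have hder (x : ℝ) : HasDerivAt φ (jac hs g.1 x) x := by
    rw [hφ]
    exact hasDerivAt_liftG hs g.1 x
  have hpos := (mem_G_iff hs).1 g.2
  have hinv : Function.invFun φ = φ.symm := funext fun y => by
    apply φ.injective
    rw [Function.invFun_eq ⟨φ.symm y, φ.apply_symm_apply y⟩, φ.apply_symm_apply]
  have hderinv (y : ℝ) : HasDerivAt φ.symm (jac hs g.1 (φ.symm y))⁻¹ y :=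
    (hder (φ.symm y)).of_local_left_inverse φ.symm.continuous.continuousAt (hpos _).ne'
      (Filter.Eventually.of_forall φ.apply_symm_apply)
  have hcomp (Z : Sobolev0 s × Sobolev (s - 1)) (y : ℝ) :
      deriv ((liftT Z).1 ∘ φ.symm) y
        = derivL (by linarith : 3 / 2 < s) (Z.1 : Sobolev s) (φ.symm y) /
          jac hs g.1 (φ.symm y) :=
    ((hasDerivAt_derivL (by linarith : 3 / 2 < s) (Z.1 : Sobolev s) (φ.symm y)).comp y
      (hderinv y)).deriv
  have h0 : φ 0 = 0 := by
    have h : (g.1.1 : Sobolev s) 0 = 0 := g.1.1.2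
    rw [hφ]
    change 0 + (g.1.1 : Sobolev s) ((0 : ℝ) : UnitAddCircle) = 0
    rw [QuotientAddGroup.mk_zero, h, add_zero]
  have h1 : φ 1 = 1 := by
    have h : (g.1.1 : Sobolev s) 0 = 0 := g.1.1.2
    rw [hφ]
    change 1 + (g.1.1 : Sobolev s) ((1 : ℝ) : UnitAddCircle) = 1
    rw [circle_one_eq_zero, QuotientAddGroup.mk_zero, h, add_zero]
  have hc (f : C(UnitAddCircle, ℝ)) : Continuous fun y : ℝ => f (φ.symm y : ℝ) :=
    (continuous_lift f).comp φ.symm.continuous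
  have hd (Z : Sobolev s) : Continuous fun y : ℝ =>
      derivL (by linarith : 3 / 2 < s) Z (φ.symm y) / jac hs g.1 (φ.symm y) :=
    (hc _).div (hc _) fun y => (hpos _).ne'
  have hsub := intervalIntegral.integral_comp_mul_deriv (a := 0) (b := 1)
    (g := fun y : ℝ => derivL (by linarith : 3 / 2 < s) (X.1 : Sobolev s) (φ.symm y) /
        jac hs g.1 (φ.symm y) * (derivL (by linarith : 3 / 2 < s) (Y.1 : Sobolev s) (φ.symm y) /
        jac hs g.1 (φ.symm y)) - X.2 (φ.symm y) * Y.2 (φ.symm y))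
    (fun x _ => hder x) (continuous_lift (toCₗ (s - 1) (jac hs g.1))).continuousOn
    (((hd _).mul (hd _)).sub ((hc _).mul (hc _)))
  rw [h0, h1] at hsub
  simp only [Function.comp_apply, φ.symm_apply_apply] at hsub
  have hm : metricG (-1) g X Y = metricId (-1) (rightTranslate (liftG g.1) (liftT X))
    (rightTranslate (liftG g.1) (liftT Y)) := rfl
  rw [hsub, hm, metricId, rightTranslate_eq, rightTranslate_eq, ← hφ, hinv]
  congr 2
  funext y
  have e : ∀ Z : Sobolev0 s × Sobolev (s - 1),
      ((liftT Z).2 ∘ φ.symm) y = Z.2 ((φ.symm y : ℝ) : UnitAddCircle) := fun _ => rfl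
  change deriv ((liftT X).1 ∘ φ.symm) y * deriv ((liftT Y).1 ∘ φ.symm) y +
    -1 * (((liftT X).2 ∘ φ.symm) y * ((liftT Y).2 ∘ φ.symm) y) = _
  rw [hcomp, hcomp, e, e]
  ring

theorem phiDiffeo_isometry (g : G s hs)
    (X Y : TangentSpace 𝓘(ℝ, Sobolev0 s × Sobolev (s - 1)) g) :
    metricU (phiDiffeo hs g)
      (mfderiv 𝓘(ℝ, Sobolev0 s × Sobolev (s - 1))
        𝓘(ℝ, PseudosphereModel (s - 1) (half_lt_sub_one hs)) (phiDiffeo hs) g X)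
      (mfderiv 𝓘(ℝ, Sobolev0 s × Sobolev (s - 1))
        𝓘(ℝ, PseudosphereModel (s - 1) (half_lt_sub_one hs)) (phiDiffeo hs) g Y) =
    metricG (-1) g X Y := by
  rw [metricU, mfderiv_inclU_phiDiffeo, mfderiv_inclU_phiDiffeo]
  exact (lorentz_fderiv_phiFun hs g.2 X Y).trans (metricG_eq hs g X Y).symm

end HunterSaxton

end

theorem theorem3p2 (s : ℝ) (hs : 5 / 2 < s) :
    ∃ Φ : G s hs ≃ₘ^∞⟮𝓘(ℝ, Sobolev0 s × Sobolev (s - 1)),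
        𝓘(ℝ, PseudosphereModel (s - 1) (half_lt_sub_one hs))⟯
        pseudosphereU (s - 1) (half_lt_sub_one hs),
      (∀ (g : G s hs) (x : ℝ),
        (inclU (Φ g)).1 x = √(deriv (liftG g.1).1 x) * Real.cosh ((liftG g.1).2 x / 2) ∧
        (inclU (Φ g)).2 x = √(deriv (liftG g.1).1 x) * Real.sinh ((liftG g.1).2 x / 2)) ∧
      (∀ (f : pseudosphereU (s - 1) (half_lt_sub_one hs)) (x : ℝ),
        (liftG (Φ.symm f).1).1 x = ∫ y in (0 : ℝ)..x, ((inclU f).1 y ^ 2 - (inclU f).2 y ^ 2) ∧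
        (liftG (Φ.symm f).1).2 x = 2 * Real.artanh ((inclU f).2 x / (inclU f).1 x)) ∧
      ∀ (g : G s hs) (X Y : TangentSpace 𝓘(ℝ, Sobolev0 s × Sobolev (s - 1)) g),
        metricU (Φ g)
          (mfderiv 𝓘(ℝ, Sobolev0 s × Sobolev (s - 1))
            𝓘(ℝ, PseudosphereModel (s - 1) (half_lt_sub_one hs)) Φ g X)
          (mfderiv 𝓘(ℝ, Sobolev0 s × Sobolev (s - 1))
            𝓘(ℝ, PseudosphereModel (s - 1) (half_lt_sub_one hs)) Φ g Y) =
        metricG (-1) g X Y := by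
  refine ⟨phiDiffeo hs, fun g x => ?_, fun f x => ⟨?_, ?_⟩, phiDiffeo_isometry hs⟩
  · rw [inclU_phiDiffeo, (hasDerivAt_liftG hs g.1 x).deriv]
    exact ⟨phiFun_fst_apply hs g.2 x, phiFun_snd_apply hs g.2 x⟩
  · have h := integralCL_jac hs (psiFun hs (inclU f)) x
    rw [jac_psiFun hs (lorentz_inclU f), integralCL_apply] at h
    simp only [sqDiff_apply] at h
    exact h.symm
  · exact psiFun_snd_eq_artanh hs (inclU_pos f) x
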